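/- Throughout, strings are elements of $2^{<\mathbb N}$, $\Lambda$ is the empty string, $2^{\mathbb N}$ is Cantor space, and $[\![\sigma]\!]$ is the set of $X\in 2^{\mathbb N}$ that extend the string $\sigma$. Let $U$ be any universal (i.e. additively optimal) prefix-free machine and $\mathrm K(\sigma)=\min\{|\tau| : U(\tau)=\sigma\}$. A *continuous semimeasure* is a map $\rho:2^{<\mathbb N}\to[0,1]$ with $\rho(\Lambda)=1$ and $\rho(\sigma)\ge\rho(\sigma0)+\rho(\sigma1)$ for all $\sigma$; let $\mathbf M$ be any universal lower semicomputable continuous semimeasure, i.e. one such that every lower semicomputable continuous semimeasure $\rho$ satisfies $\rho\le c\,\mathbf M$ for some $c\in\mathbb N$. A class $\mathcal C\subseteq 2^{\mathbb N}$ is $\Pi^0_1$ if it is the complement of $\bigcup_{\sigma\in S}[\![\sigma]\!]$ for some c.e. set $S$ of strings. Let $T_n$ be the set of strings of length $n$ that are a prefix of some member of $\mathcal C$. The class $\mathcal C$ is *deep* if it is $\Pi^0_1$ and there is a computable, non-decreasing, unbounded $h:\mathbb N\to\mathbb N$ such that $\sum_{\sigma\in T_n}\mathbf M(\sigma)\le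 2^{-h(n)}$ for all $n$. Depth of a class of other objects means that the class of their codes in $2^{\mathbb N}$ is deep, where a sequence $(F_i)$ of finite sets of strings is coded by the characteristic sequence of $\{(i,\sigma):\sigma\in F_i\}$, a function $g:2^{<\mathbb N}\to\mathbb N$ by that of its graph, and a dyadic-valued function $D$ on strings by that of $\{(\sigma,m,s)\in 2^{<\mathbb N}\times\mathbb N\times\mathbb N : D(\sigma)=m/2^s\}$, with respect to standard numberings of pairs, triples and strings. **Theorem.** 1. Let $f,\ell,d:\mathbb N\to\mathbb N$ be computable functions such that $\ell$ is non-decreasing and $f(i)/2^{d(i)}$ takes arbitrarily large values. Let $\mathcal K_{f,\ell,d}$ be the class of sequences $(F_i)_{i\in\mathbb N}$ such that, for every $i$, $F_i$ is a set of exactly $f(i)$ strings $\sigma$ of length $\ell(i)$ with $\mathrm K(\sigma)\ge \ell(i)-d(i)$. Then $\mathcal K_{f,\ell,d}$ is deep. 2. For every $c\in\mathbb N$, the class $\mathcal{CF}_c$ of functions $g:2^{<\mathbb N}\to\mathbb N$ such that $g(\sigma)\le \mathrm K(\sigma)+c$ for all $\sigma$ and $\sum_\sigma 2^{-g(\sigma)}\le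 1$ is deep. 3. Let $g:\mathbb N\to\mathbb N$ be computable and let $r>0$ be rational. Fix any computable coding of nonnegative dyadic rationals by strings, i.e. a computable $\nu:2^{<\mathbb N}\to\mathbb N\times\mathbb N$ where $\tau$ with $\nu(\tau)=(m,s)$ is a code of $m/2^s$. Let $\mathcal W_{g,r}$ be the class of nonnegative dyadic-valued $D$ on $2^{<\mathbb N}$ with $2D(\sigma)=D(\sigma0)+D(\sigma1)$ for all $\sigma$ (martingales), $D(\Lambda)=1$, $D(\sigma)>1+r$ for all $\sigma$ with $\mathrm K(\sigma)<|\sigma|$, and such that every $D(\sigma)$ has a code of length $g(|\sigma|)$. Then $\mathcal W_{g,r}$ is deep. -/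

import Mathlib

namespace DeepClasses

/-! Finite binary strings are `List Bool` (first bit first), infinite binary sequences are
`ℕ → Bool`. -/

/-- `X ↾ n`, the string of the first `n` bits of `X`. -/
def restr (X : ℕ → Bool) (n : ℕ) : List Bool := (List.range n).map X

/-- The cylinder of all sequences that have `σ` as a prefix. -/
def cylinder (σ : List Bool) : Set (ℕ → Bool) := {X | restr X σ.length = σ}

/-- Effectively closed classes: complements of `⋃ σ ∈ S, cylinder σ` with `S` computably
enumerable. -/
def IsPi01 (C : Set (ℕ → Bool)) : Prop :=
  ∃ S : Set (List Bool), REPred (fun σ => σ ∈ S) ∧ C = (⋃ σ ∈ S, cylinder σ)ᶜ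

/-- The canonical co-c.e. tree of `C`: the strings that are a prefix of some member of `C`. -/
def canonicalTree (C : Set (ℕ → Bool)) : Set (List Bool) := {σ | (cylinder σ ∩ C).Nonempty}

/-- The `n`-th level of a tree. -/
def level (T : Set (List Bool)) (n : ℕ) : Set (List Bool) := {σ | σ ∈ T ∧ σ.length = n}

/-- The dyadic rational `m / 2 ^ s` denoted by a pair `(m, s)`. -/
def dyadic (p : ℕ × ℕ) : ℚ := (p.1 : ℚ) / 2 ^ p.2

/-- Lower semicomputability of a nonnegative function on strings: it is the pointwise limit of a
computable, nondecreasing sequence of dyadic rationals. -/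
def LowerSemicomputable (ρ : List Bool → ℝ) : Prop :=
  ∃ a : List Bool → ℕ → ℕ × ℕ, Computable₂ a ∧
    (∀ σ, Monotone fun i => dyadic (a σ i)) ∧
    ∀ σ, Filter.Tendsto (fun i => ((dyadic (a σ i) : ℚ) : ℝ)) Filter.atTop (nhds (ρ σ))

/-- Continuous semimeasures. -/
structure IsSemimeasure (ρ : List Bool → ℝ) : Prop where
  nonneg : ∀ σ, 0 ≤ ρ σ
  root : ρ [] = 1
  split : ∀ σ, ρ (σ ++ [false]) + ρ (σ ++ [true]) ≤ ρ σ

/-- Universal lower semicomputable continuous semimeasures. -/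
structure IsUniversalSemimeasure (M : List Bool → ℝ) : Prop where
  semimeasure : IsSemimeasure M
  lowerSemicomputable : LowerSemicomputable M
  dominates : ∀ ρ : List Bool → ℝ, IsSemimeasure ρ → LowerSemicomputable ρ →
    ∃ c : ℕ, ∀ σ, ρ σ ≤ c * M σ

/-- Computable orders: computable, nondecreasing and unbounded functions. -/
structure IsComputableOrder (h : ℕ → ℕ) : Prop where
  computable : Computable h
  monotone : Monotone h
  unbounded : ∀ k, ∃ n, k ≤ h n

/-- Depth of an effectively closed class, with respect to the universal semimeasure `M`. The
inequality is not strict, because `M [] = 1`: at `n = 0` the strict one would fail for every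
nonempty class. -/
def IsDeep (M : List Bool → ℝ) (C : Set (ℕ → Bool)) : Prop :=
  IsPi01 C ∧ ∃ h : ℕ → ℕ, IsComputableOrder h ∧
    ∀ n, ∑' σ : level (canonicalTree C) n, M σ ≤ (1 / 2 : ℝ) ^ h n

/-- Prefix-free machines: partial computable functions on strings whose domain is prefix-free. -/
structure IsPrefixFreeMachine (V : List Bool →. List Bool) : Prop where
  partrec : Partrec V
  prefixFree : ∀ σ τ, (V σ).Dom → (V τ).Dom → σ <+: τ → σ = τ

/-- Universal (optimal) prefix-free machines: every prefix-free machine is simulated with descriptions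
that are longer by at most an additive constant. Machines that are universal by
adjunction, `U (ρ ++ τ) = V τ` for a fixed `ρ` depending on `V`, are of this kind. -/
structure IsUniversalMachine (U : List Bool →. List Bool) : Prop where
  machine : IsPrefixFreeMachine U
  optimal : ∀ V, IsPrefixFreeMachine V →
    ∃ c : ℕ, ∀ τ σ, σ ∈ V τ → ∃ τ', σ ∈ U τ' ∧ τ'.length ≤ τ.length + c

/-- Prefix-free complexity: the least length of a `U`-description of `σ` (one exists whenever `U`
is universal). -/
noncomputable def complexity (U : List Bool →. List Bool) (σ : List Bool) : ℕ :=
  sInf {n | ∃ τ : List Bool, τ.length = n ∧ σ ∈ U τ}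

open Classical in
/-- The characteristic sequence of a set `A` of finite objects, through their standard codes. -/
noncomputable def charSeq {α : Type} [Primcodable α] (A : Set α) : ℕ → Bool :=
  fun n => decide (∃ a ∈ A, Encodable.encode a = n)

/-- Sequences `F` of finite sets of strings where `F i` consists of `f i` strings `σ` of length
`ℓ i` with `K σ ≥ ℓ i - d i`. -/
def ComplexSets (U : List Bool →. List Bool) (f ℓ d : ℕ → ℕ) : Set (ℕ → Finset (List Bool)) :=
  {F | ∀ i, (F i).card = f i ∧
    ∀ σ ∈ F i, σ.length = ℓ i ∧ (ℓ i : ℤ) - d i ≤ complexity U σ}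

/-- `ComplexSets` as a class of sequences: `F` is coded by its membership relation. -/
def complexSetsClass (U : List Bool →. List Bool) (f ℓ d : ℕ → ℕ) : Set (ℕ → Bool) :=
  (fun F : ℕ → Finset (List Bool) => charSeq {p : ℕ × List Bool | p.2 ∈ F p.1}) ''
    ComplexSets U f ℓ d

/-- Compression functions with constant `c`. -/
def CompressionFunctions (U : List Bool →. List Bool) (c : ℕ) : Set (List Bool → ℕ) :=
  {g | (∀ σ, g σ ≤ complexity U σ + c) ∧
    Summable (fun σ => (1 / 2 : ℝ) ^ g σ) ∧ ∑' σ, (1 / 2 : ℝ) ^ g σ ≤ 1}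

/-- `CompressionFunctions` as a class of sequences: `g` is coded by its graph. -/
def compressionClass (U : List Bool →. List Bool) (c : ℕ) : Set (ℕ → Bool) :=
  (fun g : List Bool → ℕ => charSeq {p : List Bool × ℕ | g p.1 = p.2}) ''
    CompressionFunctions U c

/-- Martingales (with finite rational values). -/
structure IsMartingale (D : List Bool → ℚ) : Prop where
  nonneg : ∀ σ, 0 ≤ D σ
  fair : ∀ σ, 2 * D σ = D (σ ++ [false]) + D (σ ++ [true])

/-- Dyadic-valued martingales `D` with `D Λ = 1`, with `D σ > 1 + r` whenever `K σ < |σ|`, and such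
that each value `D σ` has a code of `g |σ|` bits, where the string `τ` is the code of the dyadic
rational `dyadic (ν τ)`. -/
def DominatingMartingales (U : List Bool →. List Bool) (ν : List Bool → ℕ × ℕ)
    (g : ℕ → ℕ) (r : ℚ) : Set (List Bool → ℚ) :=
  {D | IsMartingale D ∧ D [] = 1 ∧
    (∀ σ : List Bool, complexity U σ < σ.length → 1 + r < D σ) ∧
    ∀ σ : List Bool, ∃ τ : List Bool, τ.length = g σ.length ∧ D σ = dyadic (ν τ)}

/-- `DominatingMartingales` as a class of sequences: `D` is coded by the set of all
triples `(σ, m, s)` with `D σ = m / 2 ^ s`. -/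
def martingaleClass (U : List Bool →. List Bool) (ν : List Bool → ℕ × ℕ)
    (g : ℕ → ℕ) (r : ℚ) : Set (ℕ → Bool) :=
  (fun D : List Bool → ℚ => charSeq {p : List Bool × ℕ × ℕ | D p.1 = dyadic p.2}) ''
    DominatingMartingales U ν g r

end DeepClasses

/-! All three parts come from one criterion, `isDeep_of_complex_strings`. Suppose every member of a
$\Pi^0_1$ class computes, for each $m$ and with computably bounded use, a set of at least
$2^{m+\ell-L}$ strings of length $\ell$, all of complexity at least $L+2m+2$ (with $\ell$, $L$
computable in $m$). Let $N$ bound the use, so that a prefix $\tau$ of length $N$ already determines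
the set.

Since $\mathbf M$ is approximable from below, one can enumerate greedily strings $\sigma$ of length
$\ell$ such that the prefixes $\tau$ whose set contains $\sigma$, but no string selected earlier,
have total weight above $2^{-L}$. These portions of weight are disjoint, so at most $2^L$ strings
are selected (`length_selection_le`). Each is described by $m$ and an $L$-bit index, and so has
complexity at most $L+m+1+c$ (`IsUniversalMachine.exists_const`). For $m\ge c$ this is too simple to
occur in a set computed by a member of the class. Hence for $\tau$ in the tree every element of its
set is fresh, while after the selection stops each $\sigma$ carries fresh weight at most $2^{-L}$
(`exists_selection_final`). Counting pairs $(\sigma,\tau)$ gives (tree weight)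
$\cdot\,2^{m+\ell-L}\le 2^\ell 2^{-L}$, so the level $N$ has weight at most $2^{-m}$.

The required sets are some $F_i$ with $f(i)/2^{d(i)}$ large; the strings with $g(\sigma)\ge\ell$;
and the strings with $D(\sigma)\le 1+r$. The $\Pi^0_1$ claims hold because each class is defined by
universally quantified truth-table conditions: bounds on $\mathrm K$ quantify over programs and
running times, and existence requirements have computably bounded witnesses. -/

namespace DeepClasses
open Encodable

/-! ### Computability toolkit -/

attribute [fun_prop] Computable

section Computability

variable {α β γ : Type*} [Primcodable α] [Primcodable β] [Primcodable γ]

@[fun_prop]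
theorem computable_id : Computable (fun a : α => a) := Computable.id

@[fun_prop]
theorem computable_const (b : β) : Computable (fun _ : α => b) := Computable.const b

@[fun_prop]
theorem computable_comp {f : β → γ} {g : α → β} (hf : Computable f) (hg : Computable g) :
    Computable (fun a => f (g a)) := hf.comp hg

@[fun_prop]
theorem computable_fst {f : α → β × γ} (hf : Computable f) : Computable (fun a => (f a).1) :=
  Computable.fst.comp hf

@[fun_prop]
theorem computable_snd {f : α → β × γ} (hf : Computable f) : Computable (fun a => (f a).2) :=
  Computable.snd.comp hf

@[fun_prop]
theorem computable_mk {f : α → β} {g : α → γ} (hf : Computable f) (hg : Computable g) :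
    Computable (fun a => (f a, g a)) := hf.pair hg

@[fun_prop]
theorem computable_add {f g : α → ℕ} (hf : Computable f) (hg : Computable g) :
    Computable (fun a => f a + g a) := Primrec.nat_add.to_comp.comp hf hg

@[fun_prop]
theorem computable_sub {f g : α → ℕ} (hf : Computable f) (hg : Computable g) :
    Computable (fun a => f a - g a) := Primrec.nat_sub.to_comp.comp hf hg

@[fun_prop]
theorem computable_mul {f g : α → ℕ} (hf : Computable f) (hg : Computable g) :
    Computable (fun a => f a * g a) := Primrec.nat_mul.to_comp.comp hf hg

@[fun_prop]
theorem computable_pow {f g : α → ℕ} (hf : Computable f) (hg : Computable g) :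
    Computable (fun a => f a ^ g a) := by
  have h : Primrec₂ (fun a b : ℕ => a ^ b) := Primrec₂.unpaired'.1 Nat.Primrec.pow
  exact h.to_comp.comp hf hg

@[fun_prop]
theorem computable_max {f g : α → ℕ} (hf : Computable f) (hg : Computable g) :
    Computable (fun a => max (f a) (g a)) := Primrec.nat_max.to_comp.comp hf hg

@[fun_prop]
theorem computable_unpair {f : α → ℕ} (hf : Computable f) :
    Computable (fun a => (f a).unpair) := Computable.unpair.comp hf

@[fun_prop]
theorem computable_decide_le {f g : α → ℕ} (hf : Computable f) (hg : Computable g) :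
    Computable (fun a => decide (f a ≤ g a)) := Primrec.nat_le.decide.to_comp.comp hf hg

@[fun_prop]
theorem computable_succ {f : α → ℕ} (hf : Computable f) : Computable (fun a => (f a).succ) :=
  Computable.succ.comp hf

@[fun_prop]
theorem computable_beq [inst : BEq β] [LawfulBEq β] {f g : α → β} (hf : Computable f)
    (hg : Computable g) : Computable (fun a => f a == g a) := by
  classical
  obtain rfl : inst = instBEqOfDecidableEq := lawful_beq_subsingleton _ _
  exact Primrec.beq.to_comp.comp hf hg

@[fun_prop]
theorem computable_and {f g : α → Bool} (hf : Computable f) (hg : Computable g) :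
    Computable (fun a => f a && g a) := Primrec.and.to_comp.comp hf hg

@[fun_prop]
theorem computable_or {f g : α → Bool} (hf : Computable f) (hg : Computable g) :
    Computable (fun a => f a || g a) := Primrec.or.to_comp.comp hf hg

@[fun_prop]
theorem computable_not {f : α → Bool} (hf : Computable f) :
    Computable (fun a => !f a) := Primrec.not.to_comp.comp hf

@[fun_prop]
theorem computable_cond {c : α → Bool} {f g : α → β} (hc : Computable c) (hf : Computable f)
    (hg : Computable g) : Computable (fun a => bif c a then f a else g a) := hc.cond hf hg

@[fun_prop]
theorem computable_encode {f : α → β} (hf : Computable f) :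
    Computable (fun a => encode (f a)) := Computable.encode.comp hf

@[fun_prop]
theorem computable_decode {f : α → ℕ} (hf : Computable f) :
    Computable (fun a => (decode (f a) : Option β)) := Computable.decode.comp hf

@[fun_prop]
theorem computable_decode₂ {f : α → ℕ} (hf : Computable f) :
    Computable (fun a => decode₂ β (f a)) := Primrec.decode₂.to_comp.comp hf

@[fun_prop]
theorem computable_some {f : α → β} (hf : Computable f) :
    Computable (fun a => some (f a)) := Computable.option_some.comp hf

@[fun_prop]
theorem computable_option_elim {f : α → Option β} {g : α → γ} {h : α → β → γ}
    (hf : Computable f) (hg : Computable g) (hh : Computable (fun p : α × β => h p.1 p.2)) :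
    Computable (fun a => (f a).elim (g a) (h a)) :=
  (Computable.option_casesOn (g := h) hf hg hh).of_eq fun a => by cases f a <;> rfl

@[fun_prop]
theorem computable_option_isSome {f : α → Option β} (hf : Computable f) :
    Computable (fun a => (f a).isSome) := Primrec.option_isSome.to_comp.comp hf

@[fun_prop]
theorem computable_nat_rec {f : α → ℕ} {g : α → β} {h : α → ℕ → β → β} (hf : Computable f)
    (hg : Computable g) (hh : Computable (fun p : α × ℕ × β => h p.1 p.2.1 p.2.2)) :
    Computable (fun a => Nat.rec (motive := fun _ => β) (g a) (h a) (f a)) :=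
  Computable.nat_rec (h := fun a p => h a p.1 p.2) hf hg hh

@[fun_prop]
theorem computable_length {f : α → List β} (hf : Computable f) :
    Computable (fun a => (f a).length) := Computable.list_length.comp hf

@[fun_prop]
theorem computable_cons {f : α → β} {g : α → List β} (hf : Computable f) (hg : Computable g) :
    Computable (fun a => f a :: g a) := Computable.list_cons.comp hf hg

@[fun_prop]
theorem computable_append {f g : α → List β} (hf : Computable f) (hg : Computable g) :
    Computable (fun a => f a ++ g a) := Computable.list_append.comp hf hg

@[fun_prop]
theorem computable_range {f : α → ℕ} (hf : Computable f) :
    Computable (fun a => List.range (f a)) := Primrec.list_range.to_comp.comp hf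

@[fun_prop]
theorem computable_drop {f : α → ℕ} {g : α → List β} (hf : Computable f) (hg : Computable g) :
    Computable (fun a => (g a).drop (f a)) := Primrec.list_drop.to_comp.comp hf hg

@[fun_prop]
theorem computable_idxOf [inst : BEq β] [LawfulBEq β] {f : α → β} {g : α → List β}
    (hf : Computable f) (hg : Computable g) : Computable (fun a => (g a).idxOf (f a)) := by
  classical
  obtain rfl : inst = instBEqOfDecidableEq := lawful_beq_subsingleton _ _
  exact Primrec.list_idxOf.to_comp.comp hf hg

@[fun_prop]
theorem computable_getElem? {f : α → List β} {g : α → ℕ} (hf : Computable f)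
    (hg : Computable g) : Computable (fun a => (f a)[g a]?) :=
  Computable.list_getElem?.comp hf hg

@[fun_prop]
theorem computable_getD {f : α → List β} {g : α → ℕ} (b : β) (hf : Computable f)
    (hg : Computable g) : Computable (fun a => (f a).getD (g a) b) :=
  (Primrec.list_getD b).to_comp.comp hf hg

-- A fold is a recursion on the number of entries consumed. The `none` case of the lookup is never
-- reached, as the index stays below the length.
@[fun_prop]
theorem computable_foldl {f : α → List β} {g : α → γ} {h : α → γ → β → γ} (hf : Computable f)
    (hg : Computable g) (hh : Computable (fun p : α × γ × β => h p.1 p.2.1 p.2.2)) :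
    Computable (fun a => (f a).foldl (h a) (g a)) := by
  have key : Computable (fun a => Nat.rec (motive := fun _ => γ) (g a)
      (fun i s => ((f a)[i]?).elim s (fun b => h a s b)) (f a).length) := by
    have h1 : Computable (fun p : (α × ℕ × γ) × β => h p.1.1 p.1.2.2 p.2) :=
      hh.comp (f := fun p : α × γ × β => h p.1 p.2.1 p.2.2)
        (g := fun p : (α × ℕ × γ) × β => (p.1.1, p.1.2.2, p.2)) (by fun_prop)
    fun_prop
  refine key.of_eq fun a => ?_
  have : ∀ n ≤ (f a).length, Nat.rec (motive := fun _ => γ) (g a)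
      (fun i s => ((f a)[i]?).elim s (fun b => h a s b)) n = ((f a).take n).foldl (h a) (g a) := by
    intro n
    induction n with
    | zero => simp
    | succ n ih =>
      intro hn
      simp only [ih (by omega), List.getElem?_eq_getElem (show n < (f a).length by omega),
        Option.elim_some, List.take_add_one, List.foldl_append, Option.toList_some,
        List.foldl_cons, List.foldl_nil]
  simpa using this _ le_rfl

@[fun_prop]
theorem computable_map {f : α → List β} {g : α → β → γ} (hf : Computable f)
    (hg : Computable (fun p : α × β => g p.1 p.2)) :
    Computable (fun a => (f a).map (g a)) := by
  have h1 : Computable (fun p : α × List γ × β => g p.1 p.2.2) :=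
    hg.comp (f := fun p : α × β => g p.1 p.2)
      (g := fun p : α × List γ × β => (p.1, p.2.2)) (by fun_prop)
  have key : Computable (fun a => (f a).foldl (fun (s : List γ) b => s ++ [g a b]) []) := by
    fun_prop
  refine key.of_eq fun a => ?_
  have : ∀ (l : List β) (s : List γ), l.foldl (fun s b => s ++ [g a b]) s = s ++ l.map (g a) := by
    intro l
    induction l with
    | nil => simp
    | cons b l ih => intro s; simp [ih]
  simpa using this (f a) []

@[fun_prop]
theorem computable_flatten {f : α → List (List β)} (hf : Computable f) :
    Computable (fun a => (f a).flatten) := Primrec.list_flatten.to_comp.comp hf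

@[fun_prop]
theorem computable_sum {f : α → List ℕ} (hf : Computable f) :
    Computable (fun a => (f a).sum) := by
  have key : Computable (fun a => (f a).foldl (fun s b => s + b) 0) := by fun_prop
  exact key.of_eq fun a => (List.sum_eq_foldl).symm

@[fun_prop]
theorem computable_all {f : α → List β} {g : α → β → Bool} (hf : Computable f)
    (hg : Computable (fun p : α × β => g p.1 p.2)) :
    Computable (fun a => (f a).all (g a)) := by
  have key : Computable (fun a => ((f a).map (g a)).foldl (fun s b => s && b) true) := by fun_prop
  refine key.of_eq fun a => ?_
  have : ∀ (l : List β) (s : Bool), (l.map (g a)).foldl (fun s b => s && b) s =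
      (s && l.all (g a)) := by
    intro l
    induction l with
    | nil => simp
    | cons b l ih => intro s; simp [ih, Bool.and_assoc]
  simpa using this (f a) true

@[fun_prop]
theorem computable_any {f : α → List β} {g : α → β → Bool} (hf : Computable f)
    (hg : Computable (fun p : α × β => g p.1 p.2)) :
    Computable (fun a => (f a).any (g a)) := by
  have key : Computable (fun a => !((f a).all fun b => !g a b)) := by fun_prop
  exact key.of_eq fun a => by simp [List.not_all_eq_any_not]

@[fun_prop]
theorem computable_listMax {f : α → List ℕ} (hf : Computable f) :
    Computable (fun a => (f a).foldr max 0) := by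
  have key : Computable (fun a => (f a).foldl (fun s b => max s b) 0) := by fun_prop
  exact key.of_eq fun a => List.foldl_eq_foldr ..

/-- Computable choice by a total search. -/
theorem exists_computable_choice {p : α × ℕ → Bool} (hp : Computable p)
    (hex : ∀ a, ∃ n, p (a, n) = true) : ∃ f : α → ℕ, Computable f ∧ ∀ a, p (a, f a) = true := by
  refine ⟨fun a => Nat.find (hex a), Computable.find ⟨inferInstance, ?_⟩ hex,
    fun a => Nat.find_spec (hex a)⟩
  simp only [Prod.mk.eta, Bool.decide_eq_true]
  exact hp

@[fun_prop]
theorem computable_findGreatest {P : α → ℕ → Prop} [DecidableRel P] {f : α → ℕ}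
    (hf : Computable f) (hP : Computable (fun p : α × ℕ => decide (P p.1 p.2))) :
    Computable (fun a => Nat.findGreatest (P a) (f a)) := by
  have h1 : Computable (fun p : α × ℕ × ℕ => decide (P p.1 (p.2.1 + 1))) :=
    hP.comp (f := fun p : α × ℕ => decide (P p.1 p.2))
      (g := fun p : α × ℕ × ℕ => (p.1, p.2.1 + 1)) (by fun_prop)
  have key : Computable (fun a => Nat.rec (motive := fun _ => ℕ) 0
      (fun i s => bif decide (P a (i + 1)) then i + 1 else s) (f a)) := by fun_prop
  refine key.of_eq fun a => ?_
  induction f a with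
  | zero => simp
  | succ n ih =>
    rw [Nat.findGreatest_succ, ← ih]
    by_cases h : P a (n + 1) <;> simp [h]

/-- The computable stages of the graph of a partial computable function. -/
theorem exists_stages {f : α →. β} [DecidableEq β] (hf : Partrec f) :
    ∃ q : α × β × ℕ → Bool, Computable q ∧ ∀ a b, b ∈ f a ↔ ∃ s, q (a, b, s) = true := by
  obtain ⟨c, hc⟩ := Nat.Partrec.Code.exists_code.1 hf
  have hev : Computable (fun p : (ℕ × Nat.Partrec.Code) × ℕ => p.1.2.evaln p.1.1 p.2) :=
    Nat.Partrec.Code.primrec_evaln.to_comp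
  refine ⟨fun p => c.evaln p.2.2 (encode p.1) == some (encode p.2.1), ?_, fun a b => ?_⟩
  · have : Computable (fun p : α × β × ℕ => c.evaln p.2.2 (encode p.1)) :=
      hev.comp (g := fun p : α × β × ℕ => ((p.2.2, c), encode p.1)) (by fun_prop)
    fun_prop
  · have h1 : encode b ∈ c.eval (encode a) ↔ b ∈ f a := by
      rw [hc]; simp [encodek]
    rw [← h1, Nat.Partrec.Code.evaln_complete]
    simp

end Computability

/-! ### Strings of a given length -/

/-- The list of all strings of length `n`. -/
def strings (n : ℕ) : List (List Bool) :=
  Nat.rec (motive := fun _ => List (List Bool)) [[]]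
    (fun _ l => (l.map fun σ => [σ ++ [false], σ ++ [true]]).flatten) n

@[fun_prop]
theorem computable_strings {α : Type*} [Primcodable α] {f : α → ℕ} (hf : Computable f) :
    Computable (fun a => strings (f a)) := by
  unfold strings
  fun_prop

theorem strings_succ (n : ℕ) :
    strings (n + 1) = ((strings n).map fun σ => [σ ++ [false], σ ++ [true]]).flatten := rfl

theorem eq_concat_of_length {σ : List Bool} {n : ℕ} (h : σ.length = n + 1) :
    ∃ τ b, τ.length = n ∧ σ = τ ++ [b] := by
  rcases List.eq_nil_or_concat σ with rfl | ⟨τ, b, rfl⟩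
  · simp at h
  · exact ⟨τ, b, by simpa using h, by simp⟩

theorem mem_strings {n : ℕ} {σ : List Bool} : σ ∈ strings n ↔ σ.length = n := by
  induction n generalizing σ with
  | zero => simp [strings]
  | succ n ih =>
    simp only [strings_succ, List.mem_flatten, List.mem_map, ih]
    constructor
    · rintro ⟨_, ⟨τ, rfl, rfl⟩, h⟩
      simp only [List.mem_cons, List.not_mem_nil, or_false] at h
      rcases h with rfl | rfl <;> simp
    · intro h
      obtain ⟨τ, b, hτ, rfl⟩ := eq_concat_of_length h
      exact ⟨_, ⟨τ, hτ, rfl⟩, by cases b <;> simp⟩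

theorem sum_map_strings_succ {A : Type*} [AddCommMonoid A] (F : List Bool → A) (n : ℕ) :
    ((strings (n + 1)).map F).sum =
      ((strings n).map fun σ => F (σ ++ [false]) + F (σ ++ [true])).sum := by
  rw [strings_succ]
  induction strings n with
  | nil => simp
  | cons σ l ih =>
    rw [List.map_cons, List.flatten_cons, List.map_append, List.sum_append, ih]
    simp [add_assoc]

theorem length_strings (n : ℕ) : (strings n).length = 2 ^ n := by
  induction n with
  | zero => simp [strings]
  | succ n ih =>
    have := sum_map_strings_succ (fun _ => 1) n
    simp only [List.map_const', List.sum_replicate, smul_eq_mul, mul_one, ih] at this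
    rw [this]; ring

theorem nodup_strings (n : ℕ) : (strings n).Nodup := by
  induction n with
  | zero => simp [strings]
  | succ n ih =>
    rw [strings_succ, List.nodup_flatten]
    refine ⟨by simp, ?_⟩
    rw [List.pairwise_map]
    refine ih.imp fun {σ τ} hne => ?_
    rw [List.disjoint_left]
    intro ρ h1 h2
    simp only [List.mem_cons, List.not_mem_nil, or_false] at h1 h2
    rcases h1 with rfl | rfl <;> rcases h2 with h2 | h2 <;> simp_all

/-- The finite set of all strings of length `n`. -/
def stringsOf (n : ℕ) : Finset (List Bool) := (strings n).toFinset

@[simp]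
theorem mem_stringsOf {n : ℕ} {σ : List Bool} : σ ∈ stringsOf n ↔ σ.length = n := by
  simp [stringsOf, mem_strings]

theorem sum_map_strings {A : Type*} [AddCommMonoid A] (F : List Bool → A) (n : ℕ) :
    ((strings n).map F).sum = ∑ σ ∈ stringsOf n, F σ :=
  (List.sum_toFinset F (nodup_strings n)).symm

theorem sum_stringsOf_succ {A : Type*} [AddCommMonoid A] (F : List Bool → A) (n : ℕ) :
    ∑ σ ∈ stringsOf (n + 1), F σ = ∑ σ ∈ stringsOf n, (F (σ ++ [false]) + F (σ ++ [true])) := by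
  rw [← sum_map_strings, ← sum_map_strings, sum_map_strings_succ]

theorem card_stringsOf (n : ℕ) : (stringsOf n).card = 2 ^ n := by
  rw [stringsOf, List.toFinset_card_of_nodup (nodup_strings n), length_strings]

/-! ### Restrictions -/

@[simp]
theorem length_restr (X : ℕ → Bool) (n : ℕ) : (restr X n).length = n := by simp [restr]

theorem getD_restr {X : ℕ → Bool} {n k : ℕ} (h : k < n) : (restr X n).getD k false = X k := by
  simp [restr, h]

theorem restr_succ (X : ℕ → Bool) (n : ℕ) : restr X (n + 1) = restr X n ++ [X n] := by
  simp [restr, List.range_succ]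

theorem mem_canonicalTree {C : Set (ℕ → Bool)} {σ : List Bool} :
    σ ∈ canonicalTree C ↔ ∃ X ∈ C, restr X σ.length = σ := by
  simp only [canonicalTree, cylinder, Set.mem_ofPred_eq, Set.Nonempty, Set.mem_inter_iff]
  exact ⟨fun ⟨X, h1, h2⟩ => ⟨X, h2, h1⟩, fun ⟨X, h1, h2⟩ => ⟨X, h2, h1⟩⟩

theorem mem_canonicalTree_of_append {C : Set (ℕ → Bool)} {σ : List Bool} {b : Bool}
    (h : σ ++ [b] ∈ canonicalTree C) : σ ∈ canonicalTree C := by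
  rw [mem_canonicalTree] at h ⊢
  obtain ⟨X, hX, h⟩ := h
  refine ⟨X, hX, ?_⟩
  rw [List.length_append, List.length_singleton, restr_succ] at h
  exact (List.append_inj h (by simp)).1

/-! ### Truth-table functionals and effectively closed conditions -/

section TruthTable

variable {α β γ : Type*} [Primcodable α] [Primcodable β] [Primcodable γ]

/-- Functionals computable with a computable bound on the part of the oracle that is used. -/
def TruthTable (F : α → (ℕ → Bool) → β) : Prop :=
  ∃ (u : α → ℕ) (f : α × List Bool → β), Computable u ∧ Computable f ∧
    ∀ a X n, u a ≤ n → F a X = f (a, restr X n)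

theorem TruthTable.of_computable {f : α → β} (hf : Computable f) :
    TruthTable (fun a (_ : ℕ → Bool) => f a) :=
  ⟨fun _ => 0, fun p => f p.1, by fun_prop, by fun_prop, fun _ _ _ _ => rfl⟩

theorem TruthTable.query {f : α → ℕ} (hf : Computable f) :
    TruthTable (fun a (X : ℕ → Bool) => X (f a)) :=
  ⟨fun a => f a + 1, fun p => p.2.getD (f p.1) false, by fun_prop, by fun_prop,
    fun _ _ _ h => (getD_restr h).symm⟩

theorem TruthTable.pair {F : α → (ℕ → Bool) → β} {G : α → (ℕ → Bool) → γ} (hF : TruthTable F)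
    (hG : TruthTable G) : TruthTable (fun a X => (F a X, G a X)) := by
  obtain ⟨u, f, hu, hf, h⟩ := hF
  obtain ⟨v, g, hv, hg, h'⟩ := hG
  exact ⟨fun a => max (u a) (v a), fun p => (f p, g p), by fun_prop, by fun_prop,
    fun a X n hn => by dsimp only at hn ⊢; rw [h a X n (by omega), h' a X n (by omega)]⟩

theorem TruthTable.comp {g : β → γ} {F : α → (ℕ → Bool) → β} (hg : Computable g)
    (hF : TruthTable F) : TruthTable (fun a X => g (F a X)) := by
  obtain ⟨u, f, hu, hf, h⟩ := hF
  exact ⟨u, fun p => g (f p), hu, by fun_prop, fun a X n hn => by dsimp only at hn ⊢; rw [h a X n hn]⟩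

theorem le_foldr_max {l : List ℕ} {n : ℕ} (h : n ∈ l) : n ≤ l.foldr max 0 := by
  induction l with
  | nil => simp at h
  | cons m l ih =>
    rcases List.mem_cons.1 h with rfl | h
    · simp
    · exact le_max_of_le_right (ih h)

/-- The use of finitely many evaluations is bounded by the maximum of their uses. This makes bounded
quantifiers and finite sums over the oracle available. -/
theorem TruthTable.map {F : α × β → (ℕ → Bool) → γ} {l : α → List β} (hF : TruthTable F)
    (hl : Computable l) : TruthTable (fun a X => (l a).map fun b => F (a, b) X) := by
  obtain ⟨u, f, hu, hf, h⟩ := hF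
  refine ⟨fun a => ((l a).map fun b => u (a, b)).foldr max 0,
    fun p => (l p.1).map fun b => f ((p.1, b), p.2), by fun_prop, by fun_prop,
    fun a X n hn => List.map_congr_left fun b hb => h _ X n (le_trans ?_ hn)⟩
  exact le_foldr_max (List.mem_map_of_mem hb)

theorem TruthTable.all {F : α × β → (ℕ → Bool) → Bool} {l : α → List β} (hF : TruthTable F)
    (hl : Computable l) : TruthTable (fun a X => (l a).all fun b => F (a, b) X) := by
  have h := TruthTable.comp (g := fun m : List Bool => m.all fun b => b) (by fun_prop) (hF.map hl)
  simpa [List.all_map, Function.comp_def] using h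

theorem TruthTable.any {F : α × β → (ℕ → Bool) → Bool} {l : α → List β} (hF : TruthTable F)
    (hl : Computable l) : TruthTable (fun a X => (l a).any fun b => F (a, b) X) := by
  have h := TruthTable.comp (g := fun m : List Bool => m.any fun b => b) (by fun_prop) (hF.map hl)
  simpa [List.any_map, Function.comp_def] using h

/-- Effectively closed conditions on sequences. -/
def EffClosed (P : (ℕ → Bool) → Prop) : Prop :=
  ∃ F : ℕ → (ℕ → Bool) → Bool, TruthTable F ∧ ∀ X, P X ↔ ∀ n, F n X = true

/-- The quantifier over `α` becomes one over natural numbers by decoding, with numbers that decode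
to nothing imposing no condition. -/
theorem EffClosed.forall_tt {F : α → (ℕ → Bool) → Bool} (hF : TruthTable F) :
    EffClosed (fun X => ∀ a, F a X = true) := by
  obtain ⟨u, f, hu, hf, h⟩ := hF
  refine ⟨fun n X => (decode n : Option α).elim true (fun a => F a X),
    ⟨fun n => (decode n : Option α).elim 0 u,
      fun p => (decode p.1 : Option α).elim true (fun a => f (a, p.2)),
      by fun_prop, by fun_prop, fun n X k hk => ?_⟩, fun X => ⟨fun hX n => ?_, fun hX a => ?_⟩⟩
  · dsimp only at hk ⊢
    cases hd : (decode n : Option α) with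
    | none => rfl
    | some a => exact h a X k (by simpa [hd] using hk)
  · dsimp only
    cases (decode n : Option α) with
    | none => rfl
    | some a => exact hX a
  · simpa using hX (encode a)

theorem EffClosed.and {P Q : (ℕ → Bool) → Prop} (hP : EffClosed P) (hQ : EffClosed Q) :
    EffClosed (fun X => P X ∧ Q X) := by
  obtain ⟨F, hF, h⟩ := hP
  obtain ⟨G, hG, h'⟩ := hQ
  refine ⟨fun n X => F n X && G n X,
    TruthTable.comp (g := fun p : Bool × Bool => p.1 && p.2) (by fun_prop) (hF.pair hG), fun X => ?_⟩
  simp [h, h', forall_and]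

/-- The length of a string, read as a pair, names the condition to be tested on it; the string is
enumerated when it is long enough for the test and fails it. -/
theorem EffClosed.isPi01 {P : (ℕ → Bool) → Prop} (hP : EffClosed P) : IsPi01 {X | P X} := by
  obtain ⟨F, ⟨u, f, hu, hf, h⟩, hP⟩ := hP
  refine ⟨{σ | (decide (u σ.length.unpair.1 ≤ σ.length) && !f (σ.length.unpair.1, σ)) = true},
    ?_, ?_⟩
  · refine ComputablePred.to_re ⟨inferInstance, ?_⟩
    simp only [Set.mem_ofPred_eq, Bool.decide_eq_true]
    fun_prop
  · ext X
    simp only [Set.mem_ofPred_eq, hP, Set.mem_compl_iff, Set.mem_iUnion, cylinder, not_exists]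
    constructor
    · intro hX σ hσ hr
      simp only [Bool.and_eq_true, decide_eq_true_eq, Bool.not_eq_true'] at hσ
      have := h _ X _ hσ.1
      rw [hr, hX] at this
      rw [← this] at hσ
      exact absurd hσ.2 (by simp)
    · intro hX n
      by_contra hn
      -- This length names condition `n` and is at least the use `u n`.
      refine hX (restr X (Nat.pair n (u n))) ?_ (by simp)
      simp only [length_restr, Nat.unpair_pair, Bool.and_eq_true, decide_eq_true_eq,
        Bool.not_eq_true']
      refine ⟨Nat.right_le_pair _ _, ?_⟩
      rw [← h n X _ (Nat.right_le_pair _ _)]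
      simpa using hn

end TruthTable

/-! ### Characteristic sequences -/

section CharSeq

variable {α : Type} [Primcodable α]

theorem charSeq_encode {A : Set α} {a : α} : charSeq A (encode a) = true ↔ a ∈ A := by
  simp only [charSeq, decide_eq_true_eq]
  exact ⟨fun ⟨b, hb, h⟩ => encode_injective h ▸ hb, fun h => ⟨a, h, rfl⟩⟩

theorem decode₂_isSome_of_charSeq {A : Set α} {n : ℕ} (h : charSeq A n = true) :
    (decode₂ α n).isSome = true := by
  simp only [charSeq, decide_eq_true_eq] at h
  obtain ⟨a, -, rfl⟩ := h
  simp

/-- Values on codes do not determine a sequence: it must also vanish at numbers that code nothing.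
`decode₂` detects exact codes, whereas `decode` may also succeed on other numbers. -/
theorem eq_charSeq {A : Set α} {X : ℕ → Bool} (h1 : ∀ a, X (encode a) = true ↔ a ∈ A)
    (h2 : ∀ n, (!X n || (decode₂ α n).isSome) = true) : X = charSeq A := by
  funext n
  by_cases hn : (decode₂ α n).isSome
  · obtain ⟨a, ha⟩ := Option.isSome_iff_exists.1 hn
    obtain rfl := mem_decode₂.1 ha
    rw [Bool.eq_iff_iff, h1, charSeq_encode]
  · have h3 := h2 n
    simp only [hn, Bool.or_false, Bool.not_eq_true'] at h3
    rw [h3, eq_comm, ← Bool.not_eq_true]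
    exact fun h => hn (decode₂_isSome_of_charSeq h)

theorem effClosed_codes :
    EffClosed (fun X => ∀ n, (!X n || (decode₂ α n).isSome) = true) := by
  refine EffClosed.forall_tt ?_
  exact TruthTable.comp (g := fun p : ℕ × Bool => !p.2 || (decode₂ α p.1).isSome) (by fun_prop)
    ((TruthTable.of_computable (f := fun n : ℕ => n) (by fun_prop)).pair
      (TruthTable.query (f := fun n : ℕ => n) (by fun_prop)))

theorem charSeq_codes (A : Set α) (n : ℕ) :
    (!charSeq A n || (decode₂ α n).isSome) = true := by
  by_cases h : charSeq A n = true
  · simp [decode₂_isSome_of_charSeq h]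
  · simp [h]

end CharSeq

/-! ### Complexity bounds from machines -/

theorem idxOf_unary (m : ℕ) (τ : List Bool) :
    (List.replicate m true ++ false :: τ).idxOf false = m := by
  rw [List.idxOf_append_of_notMem (by simp [List.mem_replicate])]
  simp

/-- Programs consisting of a self-delimiting parameter `m` followed by `L m` bits of data are
simulated by a universal machine up to an additive constant. -/
theorem IsUniversalMachine.exists_const {U : List Bool →. List Bool} (hU : IsUniversalMachine U)
    {Φ : ℕ × List Bool →. List Bool} (hΦ : Partrec Φ) {L : ℕ → ℕ} (hL : Computable L) :
    ∃ c : ℕ, ∀ m τ σ, τ.length = L m → σ ∈ Φ (m, τ) →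
      ∃ τ', σ ∈ U τ' ∧ τ'.length ≤ m + 1 + L m + c := by
  let V : List Bool →. List Bool := fun x =>
    bif x.length == x.idxOf false + 1 + L (x.idxOf false) then
      Φ (x.idxOf false, x.drop (x.idxOf false + 1)) else Part.none
  have hdom : ∀ x, (V x).Dom → x.length = x.idxOf false + 1 + L (x.idxOf false) := by
    intro x hx
    by_contra hne
    simp only [V, beq_false_of_ne hne] at hx
    exact hx
  have hV : IsPrefixFreeMachine V := by
    constructor
    · refine Partrec.cond (by fun_prop) (hΦ.comp ?_) Partrec.none
      fun_prop
    · intro x y hx hy ⟨t, ht⟩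
      have h1 := hdom x hx
      have h2 := hdom y hy
      -- A string in the domain has its unary header complete, so an extension has the same header,
      -- and the header fixes the total length.
      have hmem : false ∈ x := List.idxOf_lt_length_iff.1 (by omega)
      rw [← ht, List.idxOf_append_of_mem hmem, List.length_append] at h2
      have : t = [] := List.length_eq_zero_iff.1 (by omega)
      simpa [this] using ht
  obtain ⟨c, hc⟩ := hU.optimal V hV
  refine ⟨c, fun m τ σ hτ hσ => ?_⟩
  obtain ⟨τ', h1, h2⟩ := hc (List.replicate m true ++ false :: τ) σ (by
    simp only [V, idxOf_unary]
    have h3 : (List.replicate m true ++ false :: τ).drop (m + 1) = τ := by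
      rw [List.drop_append]; simp
    rw [h3, beq_iff_eq.2 (by simp [hτ]; omega)]
    exact hσ)
  refine ⟨τ', h1, h2.trans ?_⟩
  simp [hτ]; omega

theorem complexity_le {U : List Bool →. List Bool} {σ τ : List Bool} (h : σ ∈ U τ) :
    complexity U σ ≤ τ.length := Nat.sInf_le ⟨τ, rfl, h⟩

/-- Every string has a program, of computably bounded length. -/
theorem IsUniversalMachine.exists_program_bound {U : List Bool →. List Bool}
    (hU : IsUniversalMachine U) :
    ∃ c : ℕ, ∀ σ, ∃ τ, σ ∈ U τ ∧ τ.length ≤ 2 * σ.length + 1 + c := by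
  obtain ⟨c, hc⟩ := hU.exists_const (Φ := fun p => Part.some p.2) (L := fun m => m)
    (by exact Computable.snd.partrec) (by fun_prop)
  refine ⟨c, fun σ => ?_⟩
  -- The self-delimiting program is the length of `σ` in unary followed by `σ`.
  obtain ⟨τ, h1, h2⟩ := hc σ.length σ σ rfl (Part.mem_some _)
  exact ⟨τ, h1, by omega⟩

/-- This bounds the search for the value of a compression function, so that its totality is a
truth-table condition. -/
theorem IsUniversalMachine.exists_computable_bound {U : List Bool →. List Bool}
    (hU : IsUniversalMachine U) :
    ∃ B : List Bool → ℕ, Computable B ∧ ∀ σ, complexity U σ < B σ := by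
  obtain ⟨c, hc⟩ := hU.exists_program_bound
  refine ⟨fun σ => 2 * σ.length + (c + 2), by fun_prop, fun σ => ?_⟩
  obtain ⟨τ, h1, h2⟩ := hc σ
  have := complexity_le h1
  dsimp only
  omega

theorem IsUniversalMachine.exists_program {U : List Bool →. List Bool}
    (hU : IsUniversalMachine U) (σ : List Bool) :
    ∃ τ, σ ∈ U τ ∧ τ.length = complexity U σ := by
  obtain ⟨c, hc⟩ := hU.exists_program_bound
  obtain ⟨τ, h1, -⟩ := hc σ
  obtain ⟨τ, h1, h2⟩ : complexity U σ ∈ {n | ∃ τ : List Bool, τ.length = n ∧ σ ∈ U τ} :=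
    Nat.sInf_mem ⟨τ.length, τ, rfl, h1⟩
  exact ⟨τ, h2, h1⟩

/-! ### Semimeasures on the levels of a tree -/

open Classical in
/-- The weight of the `n`-th level of the canonical tree. -/
noncomputable def treeWeight (M : List Bool → ℝ) (C : Set (ℕ → Bool)) (n : ℕ) : ℝ :=
  ∑ σ ∈ stringsOf n, if σ ∈ canonicalTree C then M σ else 0

theorem tsum_level (M : List Bool → ℝ) (C : Set (ℕ → Bool)) (n : ℕ) :
    ∑' σ : level (canonicalTree C) n, M σ = treeWeight M C n := by
  classical
  have h : level (canonicalTree C) n =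
      (((stringsOf n).filter (fun σ => σ ∈ canonicalTree C) : Finset (List Bool)) :
        Set (List Bool)) := by
    ext σ; simp [level, and_comm]
  rw [h, Finset.tsum_subtype' _ M, Finset.sum_filter, treeWeight]

namespace IsSemimeasure

variable {M : List Bool → ℝ}

theorem sum_stringsOf_le (hM : IsSemimeasure M) (n : ℕ) : ∑ σ ∈ stringsOf n, M σ ≤ 1 := by
  induction n with
  | zero => simp [stringsOf, strings, hM.root]
  | succ n ih =>
    rw [sum_stringsOf_succ]
    exact (Finset.sum_le_sum fun σ _ => hM.split σ).trans ih

/-- The tree is closed under prefixes, and a semimeasure does not gain weight when a string is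
split. -/
theorem treeWeight_antitone (hM : IsSemimeasure M) (C : Set (ℕ → Bool)) :
    Antitone (treeWeight M C) := by
  refine antitone_nat_of_succ_le fun n => ?_
  rw [treeWeight, treeWeight, sum_stringsOf_succ]
  refine Finset.sum_le_sum fun σ _ => ?_
  have h0 := hM.nonneg (σ ++ [false])
  have h1 := hM.nonneg (σ ++ [true])
  have h2 := hM.split σ
  have h3 := hM.nonneg σ
  by_cases h : σ ∈ canonicalTree C
  · rw [if_pos h]
    split_ifs <;> linarith
  · rw [if_neg h, if_neg (fun h' => h (mem_canonicalTree_of_append h')),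
      if_neg (fun h' => h (mem_canonicalTree_of_append h'))]
    simp

theorem treeWeight_le_one (hM : IsSemimeasure M) (C : Set (ℕ → Bool)) (n : ℕ) :
    treeWeight M C n ≤ 1 := by
  refine le_trans (Finset.sum_le_sum fun σ _ => ?_) (hM.sum_stringsOf_le n)
  split_ifs
  exacts [le_rfl, hM.nonneg σ]

/-- It suffices to bound the weights of the levels along a computable sequence. -/
theorem isDeep_of_levels (hM : IsSemimeasure M) {C : Set (ℕ → Bool)} (hC : IsPi01 C)
    {N : ℕ → ℕ} (hN : Computable N) (c : ℕ)
    (h : ∀ m, c ≤ m → treeWeight M C (N m) ≤ (1 / 2 : ℝ) ^ m) : IsDeep M C := by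
  -- The order at `n` is the largest `m ≤ n` whose level `N m` has been reached. If there is none it
  -- is `0`, and the trivial bound `1` suffices.
  refine ⟨hC, fun n => Nat.findGreatest (fun m => c ≤ m ∧ N m ≤ n) n, ⟨?_, ?_, ?_⟩, ?_⟩
  · refine computable_findGreatest (P := fun n m => c ≤ m ∧ N m ≤ n) (by fun_prop) ?_
    simp only [Bool.decide_and]
    fun_prop
  · intro n n' hn
    exact Nat.findGreatest_mono (fun m hm => ⟨hm.1, hm.2.trans hn⟩) hn
  · intro k
    refine ⟨max (max k c) (N (max k c)), (le_max_left k c).trans ?_⟩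
    exact Nat.le_findGreatest (le_max_left _ _) ⟨le_max_right _ _, le_max_right _ _⟩
  · intro n
    rw [tsum_level]
    beta_reduce
    by_cases h0 : Nat.findGreatest (fun m => c ≤ m ∧ N m ≤ n) n = 0
    · rw [h0, pow_zero]
      exact hM.treeWeight_le_one C n
    · obtain ⟨h1, h2⟩ := Nat.findGreatest_of_ne_zero rfl h0
      exact (hM.treeWeight_antitone C h2).trans (h _ h1)

end IsSemimeasure

/-! ### Selecting strings that receive much weight -/

/-- Addition of dyadic rationals. -/
def dyadicAdd (p q : ℕ × ℕ) : ℕ × ℕ := (p.1 * 2 ^ q.2 + q.1 * 2 ^ p.2, p.2 + q.2)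

theorem dyadic_dyadicAdd (p q : ℕ × ℕ) : dyadic (dyadicAdd p q) = dyadic p + dyadic q := by
  simp only [dyadic, dyadicAdd]
  push_cast
  rw [pow_add]
  field_simp

/-- The strings `τ` that are related to `σ` and not to any member of `A`. -/
def freshFor (r : List Bool → List Bool → Bool) (A : List (List Bool)) (σ τ : List Bool) : Bool :=
  r σ τ && !(A.any fun ρ => r ρ τ)

/-- The weight, at stage `s`, of the strings of length `n` that are fresh for `σ`. -/
def stageWeight (r : List Bool → List Bool → Bool) (b : List Bool → ℕ → ℕ × ℕ) (n : ℕ)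
    (A : List (List Bool)) (σ : List Bool) (s : ℕ) : ℕ × ℕ :=
  (strings n).foldl (fun w τ => bif freshFor r A σ τ then dyadicAdd w (b τ s) else w) (0, 0)

theorem dyadic_stageWeight (r : List Bool → List Bool → Bool) (b : List Bool → ℕ → ℕ × ℕ) (n : ℕ)
    (A : List (List Bool)) (σ : List Bool) (s : ℕ) :
    dyadic (stageWeight r b n A σ s) =
      ∑ τ ∈ stringsOf n, if freshFor r A σ τ then dyadic (b τ s) else 0 := by
  rw [← sum_map_strings, stageWeight]
  have : ∀ (l : List (List Bool)) (w : ℕ × ℕ),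
      dyadic (l.foldl (fun w τ => bif freshFor r A σ τ then dyadicAdd w (b τ s) else w) w) =
        dyadic w + (l.map fun τ => if freshFor r A σ τ then dyadic (b τ s) else 0).sum := by
    intro l
    induction l with
    | nil => simp
    | cons τ l ih =>
      intro w
      rw [List.foldl_cons, ih]
      by_cases h : freshFor r A σ τ <;> simp [h, dyadic_dyadicAdd, add_assoc]
  rw [this]
  simp [dyadic]

theorem coe_dyadic_stageWeight (r : List Bool → List Bool → Bool) (b : List Bool → ℕ → ℕ × ℕ)
    (n : ℕ) (A : List (List Bool)) (σ : List Bool) (s : ℕ) :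
    ((dyadic (stageWeight r b n A σ s) : ℚ) : ℝ) =
      ∑ τ ∈ stringsOf n, if freshFor r A σ τ then ((dyadic (b τ s) : ℚ) : ℝ) else 0 := by
  rw [dyadic_stageWeight, Rat.cast_sum]
  refine Finset.sum_congr rfl fun τ _ => ?_
  split_ifs <;> simp

/-- The first `i` steps of the selection of strings of length `ℓ` for which the weight of the fresh
strings is seen to exceed `2 ^ (-L)`. -/
def selection (r : List Bool → List Bool → Bool) (b : List Bool → ℕ → ℕ × ℕ) (n ℓ L : ℕ)
    (i : ℕ) : List (List Bool) :=
  Nat.rec (motive := fun _ => List (List Bool)) []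
    (fun i A => (decode i.unpair.1 : Option (List Bool)).elim A fun σ =>
      bif (σ.length == ℓ) && decide (2 ^ (stageWeight r b n A σ i.unpair.2).2 <
        (stageWeight r b n A σ i.unpair.2).1 * 2 ^ L) then A ++ [σ] else A) i

theorem computable_selection {f : (ℕ × List Bool) × List Bool → Bool}
    {b : List Bool × ℕ → ℕ × ℕ} {N ℓ L : ℕ → ℕ} (hf : Computable f) (hb : Computable b)
    (hN : Computable N) (hℓ : Computable ℓ) (hL : Computable L) :
    Computable (fun p : ℕ × ℕ => selection (fun σ τ => f ((p.1, σ), τ)) (fun τ s => b (τ, s))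
      (N p.1) (ℓ p.1) (L p.1) p.2) := by
  have hw : Computable (fun p : ℕ × List (List Bool) × List Bool × ℕ =>
      stageWeight (fun σ τ => f ((p.1, σ), τ)) (fun τ s => b (τ, s)) (N p.1) p.2.1 p.2.2.1
        p.2.2.2) := by
    unfold stageWeight freshFor dyadicAdd
    fun_prop
  have hs : Computable (fun q : ((ℕ × ℕ) × ℕ × List (List Bool)) × List Bool =>
      stageWeight (fun σ τ => f ((q.1.1.1, σ), τ)) (fun τ s => b (τ, s)) (N q.1.1.1) q.1.2.2 q.2
        q.1.2.1.unpair.2) :=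
    hw.comp (g := fun q : ((ℕ × ℕ) × ℕ × List (List Bool)) × List Bool =>
      (q.1.1.1, q.1.2.2, q.2, q.1.2.1.unpair.2)) (by fun_prop)
  unfold selection
  fun_prop

section Selection

variable {r : List Bool → List Bool → Bool} {b : List Bool → ℕ → ℕ × ℕ} {n ℓ L : ℕ}

theorem selection_step (r : List Bool → List Bool → Bool) (b : List Bool → ℕ → ℕ × ℕ)
    (n ℓ L i : ℕ) : selection r b n ℓ L (i + 1) =
      (decode i.unpair.1 : Option (List Bool)).elim (selection r b n ℓ L i) fun σ =>
        if σ.length = ℓ ∧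
          (1 / 2 : ℚ) ^ L < dyadic (stageWeight r b n (selection r b n ℓ L i) σ i.unpair.2)
        then selection r b n ℓ L i ++ [σ] else selection r b n ℓ L i := by
  have hlt : ∀ p : ℕ × ℕ, 2 ^ p.2 < p.1 * 2 ^ L ↔ (1 / 2 : ℚ) ^ L < dyadic p := by
    intro p
    rw [dyadic, one_div, inv_pow, ← one_div, div_lt_div_iff₀ (by positivity) (by positivity),
      one_mul]
    exact_mod_cast Iff.rfl
  have hstep : selection r b n ℓ L (i + 1) =
      (decode i.unpair.1 : Option (List Bool)).elim (selection r b n ℓ L i) fun σ =>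
        bif (σ.length == ℓ) &&
          decide (2 ^ (stageWeight r b n (selection r b n ℓ L i) σ i.unpair.2).2 <
            (stageWeight r b n (selection r b n ℓ L i) σ i.unpair.2).1 * 2 ^ L)
        then selection r b n ℓ L i ++ [σ] else selection r b n ℓ L i := rfl
  simp only [hstep, ← hlt, Bool.cond_eq_ite, Bool.and_eq_true, beq_iff_eq, decide_eq_true_eq]

theorem selection_succ (r : List Bool → List Bool → Bool) (b : List Bool → ℕ → ℕ × ℕ)
    (n ℓ L i : ℕ) : selection r b n ℓ L (i + 1) = selection r b n ℓ L i ∨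
      ∃ σ s, σ.length = ℓ ∧
        ((1 / 2 : ℚ) ^ L) < dyadic (stageWeight r b n (selection r b n ℓ L i) σ s) ∧
        selection r b n ℓ L (i + 1) = selection r b n ℓ L i ++ [σ] := by
  rw [selection_step]
  cases (decode i.unpair.1 : Option (List Bool)) with
  | none => exact Or.inl rfl
  | some σ =>
    rw [Option.elim_some]
    split_ifs with h
    · exact Or.inr ⟨σ, _, h.1, h.2, rfl⟩
    · exact Or.inl rfl

/-- Step `⟨σ, s⟩` tests `σ` against the stage-`s` weights and appends it whenever the test succeeds.
No check for repetition is needed: nothing is fresh for a string already selected. -/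
theorem selection_pair {σ : List Bool} (hσ : σ.length = ℓ) {s : ℕ}
    (h : selection r b n ℓ L (Nat.pair (encode σ) s + 1) =
      selection r b n ℓ L (Nat.pair (encode σ) s)) :
    dyadic (stageWeight r b n (selection r b n ℓ L (Nat.pair (encode σ) s)) σ s) ≤
      (1 / 2 : ℚ) ^ L := by
  rw [selection_step, Nat.unpair_pair, encodek, Option.elim_some] at h
  by_contra hlt
  rw [if_pos ⟨hσ, not_le.1 hlt⟩] at h
  simp at h

theorem selection_prefix {i j : ℕ} (h : i ≤ j) :
    selection r b n ℓ L i <+: selection r b n ℓ L j := by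
  induction j, h using Nat.le_induction with
  | base => exact List.prefix_rfl
  | succ j _ ih =>
    rcases selection_succ r b n ℓ L j with h | ⟨σ, s, -, -, h⟩
    · rwa [h]
    · rw [h]; exact ih.trans (List.prefix_append _ _)

theorem length_of_mem_selection {i : ℕ} {σ : List Bool} (h : σ ∈ selection r b n ℓ L i) :
    σ.length = ℓ := by
  induction i with
  | zero => simp [selection] at h
  | succ i ih =>
    rcases selection_succ r b n ℓ L i with h' | ⟨ρ, s, hρ, -, h'⟩
    · exact ih (h' ▸ h)
    · rw [h', List.mem_append, List.mem_singleton] at h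
      rcases h with h | rfl
      exacts [ih h, hρ]

/-- Strings fresh for the new entry are disjoint from those related to earlier entries, so each
selection adds more than $2^{-L}$ to the weight covered, which never exceeds $1$. -/
theorem length_selection_le {M : List Bool → ℝ} (hM : IsSemimeasure M)
    (hb : ∀ τ s, ((dyadic (b τ s) : ℚ) : ℝ) ≤ M τ) (i : ℕ) :
    (selection r b n ℓ L i).length ≤ 2 ^ L := by
  have key : ((selection r b n ℓ L i).length : ℝ) * (1 / 2) ^ L ≤
      ∑ τ ∈ stringsOf n, if (selection r b n ℓ L i).any (fun ρ => r ρ τ) then M τ else 0 := by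
    induction i with
    | zero => simp [selection]
    | succ i ih =>
      rcases selection_succ r b n ℓ L i with h | ⟨σ, s, -, hw, h⟩
      · rwa [h]
      · rw [h, List.length_append, List.length_singleton]
        push_cast
        rw [add_mul, one_mul]
        have hw' : ((1 / 2 : ℝ) ^ L) ≤ ∑ τ ∈ stringsOf n,
            if freshFor r (selection r b n ℓ L i) σ τ then M τ else 0 := by
          have h1 := (Rat.cast_lt (K := ℝ)).2 hw
          rw [coe_dyadic_stageWeight] at h1
          push_cast at h1
          refine h1.le.trans (Finset.sum_le_sum fun τ _ => ?_)
          split_ifs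
          exacts [hb τ s, le_rfl]
        refine (add_le_add ih hw').trans ?_
        rw [← Finset.sum_add_distrib]
        refine Finset.sum_le_sum fun τ _ => ?_
        simp only [freshFor, List.any_append, List.any_cons, List.any_nil, Bool.or_false]
        by_cases h1 : ((selection r b n ℓ L i).any fun ρ => r ρ τ) = true <;>
          by_cases h2 : r σ τ = true <;> simp [h1, h2]
  have h1 : ((selection r b n ℓ L i).length : ℝ) * (1 / 2) ^ L ≤ 1 := by
    refine key.trans (le_trans (Finset.sum_le_sum fun τ _ => ?_) (hM.sum_stringsOf_le n))
    split_ifs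
    exacts [le_rfl, hM.nonneg τ]
  rw [one_div, inv_pow, ← div_eq_mul_inv, div_le_one (by positivity)] at h1
  exact_mod_cast h1

/-- The selection stops, and then no string receives much weight from the fresh strings. -/
theorem exists_selection_final {M : List Bool → ℝ} (hM : IsSemimeasure M)
    (hb : ∀ τ s, ((dyadic (b τ s) : ℚ) : ℝ) ≤ M τ)
    (hlim : ∀ τ, Filter.Tendsto (fun s => ((dyadic (b τ s) : ℚ) : ℝ)) Filter.atTop (nhds (M τ))) :
    ∃ i, ∀ σ : List Bool, σ.length = ℓ →
      ∑ τ ∈ stringsOf n, (if freshFor r (selection r b n ℓ L i) σ τ then M τ else 0) ≤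
        (1 / 2 : ℝ) ^ L := by
  -- The lengths are bounded, so a maximal one is attained; as later lists extend earlier ones, the
  -- list is constant from there on.
  obtain ⟨i, hi⟩ : ∃ i, ∀ j, (selection r b n ℓ L j).length ≤ (selection r b n ℓ L i).length := by
    have hbdd : ∃ k, ∀ j, (selection r b n ℓ L j).length ≤ k :=
      ⟨_, length_selection_le hM hb⟩
    by_contra hcon
    push Not at hcon
    have : ∀ k, ∃ j, k ≤ (selection r b n ℓ L j).length := by
      intro k
      induction k with
      | zero => exact ⟨0, Nat.zero_le _⟩
      | succ k ih =>
        obtain ⟨j, hj⟩ := ih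
        obtain ⟨j', hj'⟩ := hcon j
        exact ⟨j', by omega⟩
    obtain ⟨k, hk⟩ := hbdd
    obtain ⟨j, hj⟩ := this (k + 1)
    exact absurd (hk j) (by omega)
  have hst : ∀ j, i ≤ j → selection r b n ℓ L j = selection r b n ℓ L i := fun j hj =>
    ((selection_prefix hj).eq_of_length_le (hi j)).symm
  refine ⟨i, fun σ hσ => ?_⟩
  have hlim' : Filter.Tendsto (fun s => ∑ τ ∈ stringsOf n,
      (if freshFor r (selection r b n ℓ L i) σ τ then ((dyadic (b τ s) : ℚ) : ℝ) else 0))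
      Filter.atTop (nhds (∑ τ ∈ stringsOf n,
        (if freshFor r (selection r b n ℓ L i) σ τ then M τ else 0))) := by
    refine tendsto_finsetSum _ fun τ _ => ?_
    split_ifs
    exacts [hlim τ, tendsto_const_nhds]
  refine le_of_tendsto hlim' (Filter.eventually_atTop.2 ⟨i, fun s hs => ?_⟩)
  -- The step that tests `σ` at stage `s` comes no earlier than `s`, when the selection is already
  -- final.
  have hle : i ≤ Nat.pair (encode σ) s := hs.trans (Nat.right_le_pair _ _)
  have h1 := selection_pair (r := r) (b := b) (n := n) (L := L) hσ (s := s)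
    (by rw [hst _ hle, hst _ (hle.trans (Nat.le_succ _))])
  have h2 := (Rat.cast_le (K := ℝ)).2 h1
  rw [hst _ hle, coe_dyadic_stageWeight] at h2
  push_cast at h2
  exact h2

end Selection

/-! ### Depth from large sets of complex strings -/

/-- Depth of classes whose members compute, for every `m`, a large set of strings of length `ℓ m`
and of complexity at least `L m + 2 m + 2`. -/
theorem isDeep_of_complex_strings {U : List Bool →. List Bool} (hU : IsUniversalMachine U)
    {M : List Bool → ℝ} (hM : IsUniversalSemimeasure M) {C : Set (ℕ → Bool)} (hC : IsPi01 C)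
    {ℓ L : ℕ → ℕ} (hℓ : Computable ℓ) (hL : Computable L)
    {R : ℕ × List Bool → (ℕ → Bool) → Bool} (hR : TruthTable R)
    (hcount : ∀ X ∈ C, ∀ m,
      2 ^ (m + ℓ m) ≤ ((stringsOf (ℓ m)).filter fun σ => R (m, σ) X = true).card * 2 ^ L m)
    (hK : ∀ X ∈ C, ∀ m σ, σ.length = ℓ m → R (m, σ) X = true →
      L m + 2 * m + 2 ≤ complexity U σ) : IsDeep M C := by
  obtain ⟨u, f, hu, hf, hRf⟩ := hR
  obtain ⟨a, ha, hmono, hlim⟩ := hM.lowerSemicomputable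
  let b : List Bool × ℕ → ℕ × ℕ := fun p => a p.1 p.2
  have hb : Computable b := ha
  -- A prefix of this length decides membership for all strings of length `ℓ m` at once.
  let N : ℕ → ℕ := fun m => ((strings (ℓ m)).map fun σ => u (m, σ)).foldr max 0
  have hN : Computable N := by fun_prop
  let sel : ℕ × ℕ → List (List Bool) := fun p => selection (fun σ τ => f ((p.1, σ), τ))
    (fun τ s => b (τ, s)) (N p.1) (ℓ p.1) (L p.1) p.2
  have hsel : Computable sel := computable_selection hf hb hN hℓ hL
  have hle : ∀ τ s, ((dyadic (b (τ, s)) : ℚ) : ℝ) ≤ M τ := fun τ s =>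
    Monotone.ge_of_tendsto (fun i j hij => Rat.cast_le.2 (hmono τ hij)) (hlim τ) s
  -- From `m` and the `t`-th string of length `L m`, the machine waits for the `t`-th selected
  -- string and outputs it.
  obtain ⟨c, hc⟩ := hU.exists_const
    (Φ := fun p => Nat.rfindOpt fun i => (sel (p.1, i))[(strings (L p.1)).idxOf p.2]?)
    (Partrec.rfindOpt (f := fun (p : ℕ × List Bool) i =>
      (sel (p.1, i))[(strings (L p.1)).idxOf p.2]?) (by
        change Computable (fun q : (ℕ × List Bool) × ℕ =>
          (sel (q.1.1, q.2))[(strings (L q.1.1)).idxOf q.1.2]?)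
        exact Computable.list_getElem?.comp
          (hsel.comp (g := fun q : (ℕ × List Bool) × ℕ => (q.1.1, q.2)) (by fun_prop))
          (by fun_prop))) hL
  have hcomp : ∀ m i σ, σ ∈ sel (m, i) → complexity U σ ≤ m + 1 + L m + c := by
    intro m i σ hσ
    obtain ⟨t, ht, htσ⟩ := List.getElem_of_mem hσ
    have htL : t < (strings (L m)).length := by
      rw [length_strings]
      exact ht.trans_le (length_selection_le hM.semimeasure hle i)
    obtain ⟨τ', h1, h2⟩ := hc m (strings (L m))[t] σ (mem_strings.1 (List.getElem_mem htL)) (by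
      simp only [(nodup_strings (L m)).idxOf_getElem t htL]
      -- The selections form a chain of prefixes, so the entry found does not depend on the step at
      -- which it is read.
      refine (Nat.rfindOpt_mono ?_).2 ⟨i, ?_⟩
      · intro ρ j k hjk hj
        simp only [Option.mem_def] at hj ⊢
        obtain ⟨l, hl⟩ := selection_prefix (r := fun σ τ => f ((m, σ), τ))
          (b := fun τ s => b (τ, s)) (n := N m) (ℓ := ℓ m) (L := L m) hjk
        change (selection _ _ _ _ _ k)[_]? = _
        rw [← hl, List.getElem?_append_left (List.getElem?_eq_some_iff.1 hj).1]
        exact hj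
      · rw [Option.mem_def, ← htσ]
        exact List.getElem?_eq_getElem ht)
    exact (complexity_le h1).trans h2
  refine hM.semimeasure.isDeep_of_levels hC hN c fun m hm => ?_
  obtain ⟨i, hi⟩ := exists_selection_final (r := fun σ τ => f ((m, σ), τ)) (n := N m) (ℓ := ℓ m)
    (L := L m) hM.semimeasure hle hlim
  have hfR : ∀ X σ, σ.length = ℓ m → f ((m, σ), restr X (N m)) = R (m, σ) X := fun X σ hσ =>
    (hRf _ X _ (le_foldr_max
      (List.mem_map_of_mem (f := fun σ => u (m, σ)) (mem_strings.2 hσ)))).symm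
  classical
  have htree : ∀ τ ∈ stringsOf (N m), τ ∈ canonicalTree C →
      (2 : ℝ) ^ (m + ℓ m) ≤ (∑ σ ∈ stringsOf (ℓ m),
        if freshFor (fun σ τ => f ((m, σ), τ)) (sel (m, i)) σ τ then (1 : ℝ) else 0) * 2 ^ L m := by
    intro τ hτ hτC
    obtain ⟨X, hX, hXτ⟩ := mem_canonicalTree.1 hτC
    rw [mem_stringsOf.1 hτ] at hXτ
    have hfresh : ∀ σ ∈ stringsOf (ℓ m),
        (freshFor (fun σ τ => f ((m, σ), τ)) (sel (m, i)) σ τ = true ↔ R (m, σ) X = true) := by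
      intro σ hσ
      rw [freshFor, ← hXτ, hfR X σ (mem_stringsOf.1 hσ)]
      -- A selected string has complexity at most `m + 1 + L m + c`, which is below `L m + 2 * m +
      -- 2` since `c ≤ m`.
      have hno : ((sel (m, i)).any fun ρ => f ((m, ρ), restr X (N m))) = false := by
        rw [List.any_eq_false]
        intro ρ hρ hρR
        have hlen := length_of_mem_selection hρ
        rw [hfR X ρ hlen] at hρR
        have h1 := hK X hX m ρ hlen hρR
        have h2 := hcomp m i ρ hρ
        omega
      simp [hno]
    have h1 := hcount X hX m
    rw [Finset.sum_boole, Finset.filter_congr hfresh]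
    exact_mod_cast h1
  -- Double counting of pairs: each `τ` in the tree has many fresh `σ`, and each `σ` carries fresh
  -- weight at most $2^{-L}$.
  have hsum : treeWeight M C (N m) * 2 ^ (m + ℓ m) ≤ 2 ^ ℓ m := by
    calc treeWeight M C (N m) * 2 ^ (m + ℓ m)
        ≤ ∑ τ ∈ stringsOf (N m), (∑ σ ∈ stringsOf (ℓ m),
            if freshFor (fun σ τ => f ((m, σ), τ)) (sel (m, i)) σ τ then M τ else 0) *
              2 ^ L m := by
          rw [treeWeight, Finset.sum_mul]
          refine Finset.sum_le_sum fun τ hτ => ?_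
          have h0 := hM.semimeasure.nonneg τ
          split_ifs with h
          · have h1 := mul_le_mul_of_nonneg_left (htree τ hτ h) h0
            refine h1.trans_eq ?_
            rw [← mul_assoc, Finset.mul_sum]
            simp only [mul_ite, mul_one, mul_zero]
          · rw [zero_mul]
            refine mul_nonneg (Finset.sum_nonneg fun σ _ => ?_) (by positivity)
            split_ifs
            exacts [h0, le_rfl]
      _ = (∑ σ ∈ stringsOf (ℓ m), ∑ τ ∈ stringsOf (N m),
            if freshFor (fun σ τ => f ((m, σ), τ)) (sel (m, i)) σ τ then M τ else 0) *
              2 ^ L m := by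
          rw [← Finset.sum_mul, Finset.sum_comm]
      _ ≤ (∑ σ ∈ stringsOf (ℓ m), (1 / 2 : ℝ) ^ L m) * 2 ^ L m := by
          gcongr with σ hσ
          exact hi σ (mem_stringsOf.1 hσ)
      _ = 2 ^ ℓ m := by
          rw [Finset.sum_const, card_stringsOf, nsmul_eq_mul, mul_assoc, ← mul_pow]
          norm_num
  rw [pow_add, ← mul_assoc] at hsum
  have h2 : treeWeight M C (N m) * 2 ^ m ≤ 1 :=
    le_of_mul_le_mul_right (by rwa [one_mul]) (by positivity : (0 : ℝ) < 2 ^ ℓ m)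
  rw [one_div, inv_pow, ← one_div]
  exact (le_div_iff₀ (by positivity)).2 h2

/-- Lower bounds on complexity become universal statements about programs, which with computable
stages are effectively closed. -/
theorem IsUniversalMachine.le_complexity_iff {U : List Bool →. List Bool}
    (hU : IsUniversalMachine U) {σ : List Bool} {k : ℕ} :
    k ≤ complexity U σ ↔ ∀ τ, σ ∈ U τ → k ≤ τ.length := by
  constructor
  · exact fun h τ hτ => h.trans (complexity_le hτ)
  · intro h
    obtain ⟨τ, h1, h2⟩ := hU.exists_program σ
    exact h2 ▸ h τ h1

/-! ### Truth-table functionals given by a fixed number of oracle queries -/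

section Queries

variable {α β : Type*} [Primcodable α] [Primcodable β]

theorem TruthTable.comp_query {g : α × Bool → β} {f : α → ℕ} (hg : Computable g)
    (hf : Computable f) : TruthTable (fun a X => g (a, X (f a))) :=
  TruthTable.comp hg ((TruthTable.of_computable computable_id).pair (TruthTable.query hf))

theorem TruthTable.comp_query₂ {g : α × Bool × Bool → β} {f₁ f₂ : α → ℕ} (hg : Computable g)
    (hf₁ : Computable f₁) (hf₂ : Computable f₂) :
    TruthTable (fun a X => g (a, X (f₁ a), X (f₂ a))) :=
  TruthTable.comp hg ((TruthTable.of_computable computable_id).pair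
    ((TruthTable.query hf₁).pair (TruthTable.query hf₂)))

theorem TruthTable.comp_query₃ {g : α × Bool × Bool × Bool → β} {f₁ f₂ f₃ : α → ℕ}
    (hg : Computable g) (hf₁ : Computable f₁) (hf₂ : Computable f₂) (hf₃ : Computable f₃) :
    TruthTable (fun a X => g (a, X (f₁ a), X (f₂ a), X (f₃ a))) :=
  TruthTable.comp hg ((TruthTable.of_computable computable_id).pair
    ((TruthTable.query hf₁).pair ((TruthTable.query hf₂).pair (TruthTable.query hf₃))))

end Queries

/-! ### Sequences of sets of complex strings -/

theorem isPi01_complexSetsClass {U : List Bool →. List Bool} (hU : IsUniversalMachine U)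
    {f ℓ d : ℕ → ℕ} (hf : Computable f) (hℓ : Computable ℓ) (hd : Computable d) :
    IsPi01 (complexSetsClass U f ℓ d) := by
  obtain ⟨q, hq, hqU⟩ := exists_stages hU.machine.partrec
  have h1 : EffClosed (fun X => ∀ p : ℕ × List Bool,
      (!X (encode p) || p.2.length == ℓ p.1) = true) :=
    EffClosed.forall_tt (TruthTable.comp_query
      (g := fun p : (ℕ × List Bool) × Bool => !p.2 || p.1.2.length == ℓ p.1.1)
      (by fun_prop) (by fun_prop))
  -- `h1` confines the `i`-th set to strings of length `ℓ i`, so its cardinality is read from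
  -- finitely many queries.
  have h2 : EffClosed (fun X => ∀ i : ℕ, 
      (((strings (ℓ i)).map fun σ => bif X (encode (i, σ)) then 1 else 0).sum == f i) = true) :=
    EffClosed.forall_tt (TruthTable.comp (g := fun p : ℕ × List ℕ => p.2.sum == f p.1)
      (by fun_prop) ((TruthTable.of_computable computable_id).pair
        (TruthTable.map (F := fun (p : ℕ × List Bool) (X : ℕ → Bool) =>
            bif X (encode (p.1, p.2)) then 1 else 0)
          (TruthTable.comp (g := fun b : Bool => bif b then 1 else 0) (by fun_prop)
            (TruthTable.query (by fun_prop))) (by fun_prop))))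
  have h3 : EffClosed (fun X => ∀ p : ℕ × List Bool × List Bool × ℕ,
      (!X (encode (p.1, p.2.1)) || !(q (p.2.2.1, p.2.1, p.2.2.2) &&
        decide (p.2.2.1.length + d p.1 < ℓ p.1))) = true) :=
    EffClosed.forall_tt (TruthTable.comp_query
      (g := fun p : (ℕ × List Bool × List Bool × ℕ) × Bool => !p.2 ||
        !(q (p.1.2.2.1, p.1.2.1, p.1.2.2.2) && decide (p.1.2.2.1.length + d p.1.1 < ℓ p.1.1)))
      (by fun_prop) (by fun_prop))
  have hall := (((effClosed_codes (α := ℕ × List Bool)).and h1).and (h2.and h3)).isPi01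
  convert hall using 1
  ext X
  simp only [Set.mem_ofPred_eq, complexSetsClass, Set.mem_image, Bool.or_eq_true,
    Bool.not_eq_true', beq_iff_eq, Bool.and_eq_false_iff, decide_eq_false_iff_not]
  constructor
  · rintro ⟨F, hF, rfl⟩
    have hmem : ∀ i σ, charSeq {p : ℕ × List Bool | p.2 ∈ F p.1} (encode (i, σ)) = true ↔
        σ ∈ F i := fun i σ => charSeq_encode
    refine ⟨⟨fun n => ?_, fun p => ?_⟩, fun i => ?_, fun p => ?_⟩
    · simpa using charSeq_codes {p : ℕ × List Bool | p.2 ∈ F p.1} n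
    · by_cases hp : p.2 ∈ F p.1
      · exact Or.inr ((hF p.1).2 p.2 hp).1
      · exact Or.inl (by rw [← Bool.not_eq_true, hmem p.1 p.2]; exact hp)
    · rw [sum_map_strings, ← (hF i).1]
      simp only [Bool.cond_eq_ite, hmem, Finset.sum_boole, Nat.cast_id]
      congr 1
      ext σ
      simp only [Finset.mem_filter, mem_stringsOf]
      exact ⟨fun h => h.2, fun h => ⟨((hF i).2 σ h).1, h⟩⟩
    · by_cases hp : p.2.1 ∈ F p.1
      · right
        by_contra! hcon
        have hlen := hcon.2
        have hU' := (hqU _ _).2 ⟨_, by simpa using hcon.1⟩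
        have h4 := ((hF p.1).2 _ hp).2
        have h5 := complexity_le hU'
        omega
      · exact Or.inl (by rw [← Bool.not_eq_true, hmem]; exact hp)
  · rintro ⟨⟨h0, h1⟩, h2, h3⟩
    refine ⟨fun i => (stringsOf (ℓ i)).filter fun σ => X (encode (i, σ)) = true,
      fun i => ⟨?_, ?_⟩, ?_⟩
    · have := h2 i
      rw [sum_map_strings] at this
      simp only [Bool.cond_eq_ite, Finset.sum_boole, Nat.cast_id] at this
      convert this
    · intro σ hσ
      simp only [Finset.mem_filter, mem_stringsOf] at hσ
      refine ⟨hσ.1, ?_⟩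
      have hle : ℓ i - d i ≤ complexity U σ := hU.le_complexity_iff.2 fun τ hτ => ?_
      · omega
      · obtain ⟨s, hs⟩ := (hqU _ _).1 hτ
        have := h3 (i, σ, τ, s)
        simp only [hσ.2, hs, Bool.true_eq_false, false_or] at this
        omega
    · refine (eq_charSeq (fun p => ?_) (fun n => by simpa using h0 n)).symm
      have := h1 p
      simp only [Set.mem_ofPred_eq, Finset.mem_filter, mem_stringsOf, Prod.mk.eta]
      constructor
      · intro h
        exact ⟨by simpa [h] using this, h⟩
      · exact fun h => h.2

theorem isDeep_complexSetsClass {U : List Bool →. List Bool} (hU : IsUniversalMachine U)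
    {M : List Bool → ℝ} (hM : IsUniversalSemimeasure M) {f ℓ d : ℕ → ℕ} (hf : Computable f)
    (hℓ : Computable ℓ) (hd : Computable d)
    (hlarge : ∀ B : ℝ, ∃ i, B < (f i : ℝ) / 2 ^ d i) : IsDeep M (complexSetsClass U f ℓ d) := by
  have hex : ∀ m : ℕ, ∃ i, 2 ^ (d i + 3 * m + 2) ≤ f i := by
    intro m
    obtain ⟨i, hi⟩ := hlarge (2 ^ (3 * m + 2))
    rw [lt_div_iff₀ (by positivity), ← pow_add] at hi
    refine ⟨i, ?_⟩
    rw [show d i + 3 * m + 2 = 3 * m + 2 + d i by ring]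
    exact_mod_cast hi.le
  -- The factor `2 ^ (3 * m + 2)` pays for `2 ^ m` in the counting bound and for the gap `2 * m + 2`
  -- in the complexity bound.
  obtain ⟨I, hI, hIspec⟩ := exists_computable_choice
    (p := fun p : ℕ × ℕ => decide (2 ^ (d p.2 + 3 * p.1 + 2) ≤ f p.2)) (by fun_prop)
    (fun m => by simpa only [decide_eq_true_eq] using hex m)
  simp only [decide_eq_true_eq] at hIspec
  -- This rules out truncation in `L` below. It is needed only when the class has a member, and then
  -- `f (I m)` strings of length `ℓ (I m)` exist.
  have hF : ∀ F ∈ ComplexSets U f ℓ d, ∀ m, d (I m) + 3 * m + 2 ≤ ℓ (I m) := by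
    intro F hF m
    have h1 : (F (I m)).card ≤ 2 ^ ℓ (I m) := by
      rw [← card_stringsOf]
      exact Finset.card_le_card fun σ hσ => mem_stringsOf.2 ((hF _).2 σ hσ).1
    rw [(hF _).1] at h1
    exact (Nat.pow_le_pow_iff_right (by norm_num)).1 ((hIspec m).trans h1)
  have hℓI : Computable (fun m => ℓ (I m)) := by fun_prop
  have hLI : Computable (fun m => ℓ (I m) - d (I m) - 2 * m - 2) := by fun_prop
  have hRI : Computable (fun p : ℕ × List Bool => encode (I p.1, p.2)) := by fun_prop
  refine isDeep_of_complex_strings hU hM (isPi01_complexSetsClass hU hf hℓ hd)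
    (ℓ := fun m => ℓ (I m)) (L := fun m => ℓ (I m) - d (I m) - 2 * m - 2)
    (R := fun p X => X (encode (I p.1, p.2))) hℓI hLI
    (TruthTable.query hRI) ?_ ?_
  · rintro _ ⟨F, hFC, rfl⟩ m
    have h1 := hF F hFC m
    have hfil : ((stringsOf (ℓ (I m))).filter fun σ =>
        charSeq {p : ℕ × List Bool | p.2 ∈ F p.1} (encode (I m, σ)) = true) = F (I m) := by
      ext σ
      simp only [Finset.mem_filter, mem_stringsOf, charSeq_encode, Set.mem_ofPred_eq]
      exact ⟨fun h => h.2, fun h => ⟨((hFC _).2 σ h).1, h⟩⟩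
    rw [hfil, (hFC _).1]
    refine le_trans (le_of_eq ?_) (Nat.mul_le_mul_right _ (hIspec m))
    rw [← pow_add]
    congr 1
    omega
  · rintro _ ⟨F, hFC, rfl⟩ m σ - hR
    have h1 := hF F hFC m
    have h2 : σ ∈ F (I m) :=
      (charSeq_encode (A := {p : ℕ × List Bool | p.2 ∈ F p.1}) (a := (I m, σ))).1 hR
    have h3 := ((hFC _).2 σ h2).2
    omega

/-! ### Compression functions -/

/-- The weight `2 ^ (-n)` of the pair coded by `k < N`, in units of `2 ^ (-N)`. -/
def pairWeight (N k : ℕ) : ℕ :=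
  (decode₂ (List Bool × ℕ) k).elim 0 fun p => 2 ^ (N - p.2)

/-- Moved to the codes of pairs in the graph, the series has nonnegative terms, so it suffices to
bound its partial sums. The sum over codes below `N` is an integer multiple of $2^{-N}$, which makes
each bound a truth-table test. -/
theorem summable_and_tsum_le_one_iff {g : List Bool → ℕ} {X : ℕ → Bool}
    (hX : X = charSeq {p : List Bool × ℕ | g p.1 = p.2}) :
    (Summable (fun σ => (1 / 2 : ℝ) ^ g σ) ∧ ∑' σ, (1 / 2 : ℝ) ^ g σ ≤ 1) ↔
      ∀ N, ((List.range N).map fun k => bif X k then pairWeight N k else 0).sum ≤ 2 ^ N := by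
  let φ : ℕ → ℝ := fun k => if X k = true then
    (decode₂ (List Bool × ℕ) k).elim 0 (fun p => (1 / 2 : ℝ) ^ p.2) else 0
  let e : List Bool → ℕ := fun σ => encode (σ, g σ)
  have he : Function.Injective e := fun σ τ h => congrArg Prod.fst (encode_injective h)
  have hXe : ∀ p : List Bool × ℕ, X (encode p) = true ↔ g p.1 = p.2 := fun p => by
    rw [hX, charSeq_encode]; rfl
  have hφe : ∀ σ, φ (e σ) = (1 / 2 : ℝ) ^ g σ := fun σ => by
    simp only [φ, e, encodek₂, Option.elim_some]
    rw [if_pos ((hXe _).2 rfl)]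
  have hφ0 : ∀ k, 0 ≤ φ k := fun k => by
    simp only [φ]
    split_ifs
    · cases decode₂ (List Bool × ℕ) k <;> simp
    · exact le_rfl
  have hsupp : ∀ k, k ∉ Set.range e → φ k = 0 := by
    intro k hk
    simp only [φ]
    split_ifs with h
    · cases hd : decode₂ (List Bool × ℕ) k with
      | none => rfl
      | some p =>
        obtain rfl := mem_decode₂.1 hd
        refine absurd ⟨p.1, ?_⟩ hk
        simp only [e, (hXe p).1 h]
    · rfl
  have hsum : ∀ N, ((((List.range N).map fun k => bif X k then pairWeight N k else 0).sum : ℕ) : ℝ)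
      = 2 ^ N * ∑ k ∈ Finset.range N, φ k := by
    intro N
    have hlist : ((List.range N).map fun k => bif X k then pairWeight N k else 0).sum =
        ∑ k ∈ Finset.range N, bif X k then pairWeight N k else 0 := rfl
    rw [hlist, Nat.cast_sum, Finset.mul_sum]
    refine Finset.sum_congr rfl fun k hk => ?_
    simp only [φ, pairWeight, Bool.cond_eq_ite]
    split_ifs
    · cases hd : decode₂ (List Bool × ℕ) k with
      | none => simp
      | some p =>
        obtain rfl := mem_decode₂.1 hd
        -- The value is at most the code of the pair, so the exponent `N - p.2` is not truncated.
        have hp : p.2 ≤ N := by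
          have h1 : p.2 ≤ encode p := by
            rw [Encodable.encode_prod_val]; exact Nat.right_le_pair _ _
          have h2 := Finset.mem_range.1 hk
          omega
        simp only [Option.elim_some]
        push_cast
        rw [pow_sub₀ _ (by norm_num) hp, one_div, inv_pow]
    · simp
  have hiff : (∀ N, ((List.range N).map fun k => bif X k then pairWeight N k else 0).sum ≤ 2 ^ N) ↔
      ∀ N, ∑ k ∈ Finset.range N, φ k ≤ 1 := by
    refine forall_congr' fun N => ?_
    rw [← Nat.cast_le (α := ℝ), hsum]
    push_cast
    constructor
    · intro h
      exact le_of_mul_le_mul_left (by rwa [mul_one]) (by positivity : (0 : ℝ) < 2 ^ N)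
    · intro h
      exact (mul_le_mul_of_nonneg_left h (by positivity)).trans_eq (mul_one _)
  have hfun : (fun σ => (1 / 2 : ℝ) ^ g σ) = φ ∘ e := funext fun σ => (hφe σ).symm
  have hts : ∑' σ, (1 / 2 : ℝ) ^ g σ = ∑' k, φ k := by
    rw [← he.tsum_eq (fun k hk => by_contra fun h => hk (hsupp k h))]
    exact tsum_congr fun σ => (hφe σ).symm
  rw [hiff, hts, hfun, he.summable_iff hsupp]
  constructor
  · rintro ⟨h1, h2⟩ N
    exact (h1.sum_le_tsum _ fun k _ => hφ0 k).trans h2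
  · intro h
    exact ⟨summable_of_sum_range_le hφ0 h, Real.tsum_le_of_sum_range_le hφ0 h⟩

theorem isPi01_compressionClass {U : List Bool →. List Bool} (hU : IsUniversalMachine U) (c : ℕ) :
    IsPi01 (compressionClass U c) := by
  obtain ⟨q, hq, hqU⟩ := exists_stages hU.machine.partrec
  obtain ⟨B, hB, hBK⟩ := hU.exists_computable_bound
  have h1 : EffClosed (fun X => ∀ p : List Bool × ℕ × ℕ,
      (!X (encode (p.1, p.2.1)) || !X (encode (p.1, p.2.2)) || p.2.1 == p.2.2) = true) :=
    EffClosed.forall_tt (TruthTable.comp_query₂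
      (g := fun p : (List Bool × ℕ × ℕ) × Bool × Bool =>
        !p.2.1 || !p.2.2 || p.1.2.1 == p.1.2.2)
      (by fun_prop) (by fun_prop) (by fun_prop))
  -- Totality of the graph; the search may be bounded since `g σ ≤ complexity U σ + c < B σ + c`.
  have h2 : EffClosed (fun X => ∀ σ : List Bool,
      ((List.range (B σ + c)).any fun n => X (encode (σ, n))) = true) :=
    EffClosed.forall_tt (TruthTable.any
      (F := fun (p : List Bool × ℕ) (X : ℕ → Bool) => X (encode (p.1, p.2)))
      (TruthTable.query (by fun_prop)) (by fun_prop))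
  have h3 : EffClosed (fun X => ∀ p : List Bool × ℕ × List Bool × ℕ,
      (!X (encode (p.1, p.2.1)) || !q (p.2.2.1, p.1, p.2.2.2) ||
        decide (p.2.1 ≤ p.2.2.1.length + c)) = true) :=
    EffClosed.forall_tt (TruthTable.comp_query
      (g := fun p : (List Bool × ℕ × List Bool × ℕ) × Bool => !p.2 ||
        !q (p.1.2.2.1, p.1.1, p.1.2.2.2) || decide (p.1.2.1 ≤ p.1.2.2.1.length + c))
      (by fun_prop) (by fun_prop))
  have hw : Computable (fun p : ℕ × ℕ => pairWeight p.1 p.2) := by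
    unfold pairWeight
    fun_prop
  have h4 : EffClosed (fun X => ∀ N : ℕ, decide
      (((List.range N).map fun k => bif X k then pairWeight N k else 0).sum ≤ 2 ^ N) = true) :=
    EffClosed.forall_tt (TruthTable.comp
      (g := fun p : ℕ × List ℕ => decide (p.2.sum ≤ 2 ^ p.1)) (by fun_prop)
      ((TruthTable.of_computable computable_id).pair
        (TruthTable.map (F := fun (p : ℕ × ℕ) (X : ℕ → Bool) =>
            bif X p.2 then pairWeight p.1 p.2 else 0)
          (TruthTable.comp_query
            (g := fun p : (ℕ × ℕ) × Bool => bif p.2 then pairWeight p.1.1 p.1.2 else 0)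
            (by fun_prop) (by fun_prop)) (by fun_prop))))
  have hall := (((effClosed_codes (α := List Bool × ℕ)).and h1).and
    ((h2.and h3).and h4)).isPi01
  convert hall using 1
  ext X
  simp only [Set.mem_ofPred_eq, compressionClass, Set.mem_image, Bool.or_eq_true,
    Bool.not_eq_true', decide_eq_true_eq, beq_iff_eq, List.any_eq_true, List.mem_range, or_assoc]
  constructor
  · rintro ⟨g, ⟨hg1, hg2⟩, rfl⟩
    have hmem : ∀ σ n, charSeq {p : List Bool × ℕ | g p.1 = p.2} (encode (σ, n)) = true ↔
        g σ = n := fun σ n => charSeq_encode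
    have hor : ∀ σ n (P : Prop), (g σ = n → P) →
        (charSeq {p : List Bool × ℕ | g p.1 = p.2} (encode (σ, n)) = false ∨ P) := by
      intro σ n P h
      rw [← Bool.not_eq_true, hmem]
      exact not_or_of_imp h
    refine ⟨⟨fun n => ?_, fun p => ?_⟩, ⟨fun σ => ?_, fun p => ?_⟩, ?_⟩
    · simpa using charSeq_codes {p : List Bool × ℕ | g p.1 = p.2} n
    · exact hor _ _ _ fun h => hor _ _ _ fun h' => h ▸ h'
    · refine ⟨g σ, ?_, (hmem _ _).2 rfl⟩
      have := hg1 σ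
      have := hBK σ
      omega
    · refine hor _ _ _ fun h => ?_
      by_cases hs : q (p.2.2.1, p.1, p.2.2.2) = true
      · right
        have h3 := complexity_le ((hqU _ _).2 ⟨_, hs⟩)
        have := hg1 p.1
        omega
      · exact Or.inl (by simpa using hs)
    · exact (summable_and_tsum_le_one_iff rfl).1 hg2
  · rintro ⟨⟨h0, h1⟩, ⟨h2, h3⟩, h4⟩
    choose g hg1 hg2 using h2
    have hX : X = charSeq {p : List Bool × ℕ | g p.1 = p.2} := by
      refine eq_charSeq (fun p => ⟨fun h => ?_, fun h => ?_⟩) (fun n => by simpa using h0 n)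
      · simpa [hg2, h, ← Encodable.encode_prod_val] using h1 (p.1, g p.1, p.2)
      · have := hg2 p.1
        rwa [show g p.1 = p.2 from h] at this
    refine ⟨g, ⟨fun σ => ?_, (summable_and_tsum_le_one_iff hX).2 h4⟩, hX.symm⟩
    obtain ⟨τ, hτ, hτK⟩ := hU.exists_program σ
    obtain ⟨s, hs⟩ := (hqU _ _).1 hτ
    have := h3 (σ, g σ, τ, s)
    simp only [hg2, hs, Bool.true_eq_false, false_or] at this
    omega

theorem isDeep_compressionClass {U : List Bool →. List Bool} (hU : IsUniversalMachine U)
    {M : List Bool → ℝ} (hM : IsUniversalSemimeasure M) (c : ℕ) :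
    IsDeep M (compressionClass U c) := by
  have hR : TruthTable (fun (p : ℕ × List Bool) X =>
      (List.range (c + 3 * p.1 + 3)).all fun j => !X (encode (p.2, j))) :=
    TruthTable.all (F := fun (p : (ℕ × List Bool) × ℕ) (X : ℕ → Bool) => !X (encode (p.1.2, p.2)))
      (TruthTable.comp (g := fun b : Bool => !b) (by fun_prop) (TruthTable.query (by fun_prop)))
      (by fun_prop)
  have hRg : ∀ (g : List Bool → ℕ) n σ, ((List.range n).all fun j =>
      !charSeq {p : List Bool × ℕ | g p.1 = p.2} (encode (σ, j))) = true ↔ n ≤ g σ := by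
    intro g n σ
    simp only [List.all_eq_true, List.mem_range, Bool.not_eq_true', ← Bool.not_eq_true,
      charSeq_encode, Set.mem_ofPred_eq]
    exact ⟨fun h => not_lt.1 fun h' => h _ h' rfl, fun h j hj => by omega⟩
  -- The set consists of the strings of length `ℓ` with `g σ ≥ ℓ`, hence of complexity at least `ℓ -
  -- c = L + 2 * m + 2`. It contains at least half of all strings, whence `L = m + 1`.
  refine isDeep_of_complex_strings hU hM (isPi01_compressionClass hU c)
    (ℓ := fun m => c + 3 * m + 3) (L := fun m => m + 1) (by fun_prop) (by fun_prop) hR ?_ ?_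
  · rintro _ ⟨g, ⟨-, hg1, hg2⟩, rfl⟩ m
    simp only [hRg]
    set ℓ := c + 3 * m + 3 with hℓ
    -- Each string with `g σ < ℓ` contributes at least $2^{-(\ell-1)}$ to a sum that is at most $1$.
    have hbad : ((stringsOf ℓ).filter fun σ => ¬ ℓ ≤ g σ).card * 2 ≤ 2 ^ ℓ := by
      have h1 : ∑ σ ∈ (stringsOf ℓ).filter (fun σ => ¬ ℓ ≤ g σ), (1 / 2 : ℝ) ^ (ℓ - 1) ≤ 1 := by
        refine le_trans (Finset.sum_le_sum fun σ hσ => ?_)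
          ((hg1.sum_le_tsum _ fun σ _ => by positivity).trans hg2)
        have := (Finset.mem_filter.1 hσ).2
        exact pow_le_pow_of_le_one (by norm_num) (by norm_num) (by omega)
      rw [Finset.sum_const, nsmul_eq_mul, one_div, inv_pow, ← div_eq_mul_inv,
        div_le_one (by positivity)] at h1
      have h2 : ((stringsOf ℓ).filter fun σ => ¬ ℓ ≤ g σ).card ≤ 2 ^ (ℓ - 1) := by
        exact_mod_cast h1
      calc _ ≤ 2 ^ (ℓ - 1) * 2 := Nat.mul_le_mul_right _ h2
        _ = 2 ^ ℓ := by rw [← pow_succ]; congr 1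
    have hcard := Finset.card_filter_add_card_filter_not (s := stringsOf ℓ) (fun σ => ℓ ≤ g σ)
    rw [card_stringsOf] at hcard
    have h3 : 2 ^ ℓ ≤ ((stringsOf ℓ).filter fun σ => ℓ ≤ g σ).card * 2 := by omega
    calc 2 ^ (m + ℓ) = 2 ^ ℓ * 2 ^ m := by rw [← pow_add, add_comm]
      _ ≤ ((stringsOf ℓ).filter fun σ => ℓ ≤ g σ).card * 2 * 2 ^ m := Nat.mul_le_mul_right _ h3
      _ = _ := by rw [pow_succ]; ring
  · rintro _ ⟨g, ⟨hg, -⟩, rfl⟩ m σ - hσ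
    have h1 := (hRg g _ σ).1 hσ
    have h2 := hg σ
    omega

/-! ### Dominating martingales -/

/-- Equality of dyadic rationals. -/
def dyadicEq (p q : ℕ × ℕ) : Bool := p.1 * 2 ^ q.2 == q.1 * 2 ^ p.2

theorem dyadicEq_iff {p q : ℕ × ℕ} : dyadicEq p q = true ↔ dyadic p = dyadic q := by
  rw [dyadicEq, beq_iff_eq, dyadic, dyadic, div_eq_div_iff (by positivity) (by positivity)]
  exact_mod_cast Iff.rfl

/-- The comparison `1 + a / b < p`, for a dyadic rational `p`. -/
def dyadicGt (a b : ℕ) (p : ℕ × ℕ) : Bool := decide ((b + a) * 2 ^ p.2 < p.1 * b)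

@[fun_prop]
theorem computable_dyadicGt {α : Type*} [Primcodable α] (a b : ℕ) {f : α → ℕ × ℕ}
    (hf : Computable f) : Computable (fun x => dyadicGt a b (f x)) := by
  unfold dyadicGt
  fun_prop

theorem dyadicGt_iff {r : ℚ} (hr : 0 < r) {p : ℕ × ℕ} :
    dyadicGt r.num.toNat r.den p = true ↔ 1 + r < dyadic p := by
  have hb : (0 : ℚ) < r.den := by exact_mod_cast r.den_pos
  have ha : ((r.num.toNat : ℕ) : ℚ) = r.num := by
    have : ((r.num.toNat : ℕ) : ℤ) = r.num := Int.toNat_of_nonneg (Rat.num_pos.2 hr).le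
    exact_mod_cast this
  have h1 : 1 + r = ((r.den : ℚ) + (r.num.toNat : ℕ)) / r.den := by
    rw [ha, add_div, div_self hb.ne', Rat.num_div_den]
  rw [dyadicGt, decide_eq_true_eq, h1, dyadic, div_lt_div_iff₀ hb (by positivity)]
  exact_mod_cast Iff.rfl

theorem isPi01_martingaleClass {U : List Bool →. List Bool} (hU : IsUniversalMachine U)
    {ν : List Bool → ℕ × ℕ} {g : ℕ → ℕ} {r : ℚ} (hν : Computable ν) (hg : Computable g)
    (hr : 0 < r) : IsPi01 (martingaleClass U ν g r) := by
  obtain ⟨q, hq, hqU⟩ := exists_stages hU.machine.partrec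
  -- A value has many representations `m / 2 ^ s`; once one is listed, exactly the equal ones must
  -- be.
  have h1 : EffClosed (fun X => ∀ p : List Bool × (ℕ × ℕ) × (ℕ × ℕ),
      (!X (encode (p.1, p.2.1)) || X (encode (p.1, p.2.2)) == dyadicEq p.2.1 p.2.2) = true) := by
    refine EffClosed.forall_tt (TruthTable.comp_query₂
      (g := fun p : (List Bool × (ℕ × ℕ) × (ℕ × ℕ)) × Bool × Bool =>
        !p.2.1 || p.2.2 == dyadicEq p.1.2.1 p.1.2.2) ?_ (by fun_prop) (by fun_prop))
    unfold dyadicEq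
    fun_prop
  -- The bound on code lengths leaves finitely many candidate values, so the existence of a value is
  -- a truth-table condition.
  have h2 : EffClosed (fun X => ∀ σ : List Bool,
      ((strings (g σ.length)).any fun τ => X (encode (σ, ν τ))) = true) :=
    EffClosed.forall_tt (TruthTable.any
      (F := fun (p : List Bool × List Bool) (X : ℕ → Bool) => X (encode (p.1, ν p.2)))
      (TruthTable.query (by fun_prop)) (by fun_prop))
  have h3 : EffClosed (fun X => ∀ p : List Bool × (ℕ × ℕ) × (ℕ × ℕ) × (ℕ × ℕ),
      (!X (encode (p.1, p.2.1)) || !X (encode (p.1 ++ [false], p.2.2.1)) ||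
        !X (encode (p.1 ++ [true], p.2.2.2)) ||
        dyadicEq (2 * p.2.1.1, p.2.1.2) (dyadicAdd p.2.2.1 p.2.2.2)) = true) := by
    refine EffClosed.forall_tt (TruthTable.comp_query₃
      (g := fun p : (List Bool × (ℕ × ℕ) × (ℕ × ℕ) × (ℕ × ℕ)) × Bool × Bool × Bool =>
        !p.2.1 || !p.2.2.1 || !p.2.2.2 ||
          dyadicEq (2 * p.1.2.1.1, p.1.2.1.2) (dyadicAdd p.1.2.2.1 p.1.2.2.2))
      ?_ (by fun_prop) (by fun_prop) (by fun_prop))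
    unfold dyadicEq dyadicAdd
    fun_prop
  have h4 : EffClosed (fun X => ∀ _ : Unit,
      X (encode (([], (1, 0)) : List Bool × ℕ × ℕ)) = true) :=
    EffClosed.forall_tt (TruthTable.query (by fun_prop))
  have h5 : EffClosed (fun X => ∀ p : List Bool × (ℕ × ℕ) × List Bool × ℕ,
      (!X (encode (p.1, p.2.1)) || !q (p.2.2.1, p.1, p.2.2.2) ||
        decide (p.1.length ≤ p.2.2.1.length) || dyadicGt r.num.toNat r.den p.2.1) = true) := by
    refine EffClosed.forall_tt (TruthTable.comp_query
      (g := fun p : (List Bool × (ℕ × ℕ) × List Bool × ℕ) × Bool => !p.2 ||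
        !q (p.1.2.2.1, p.1.1, p.1.2.2.2) || decide (p.1.1.length ≤ p.1.2.2.1.length) ||
          dyadicGt r.num.toNat r.den p.1.2.1) ?_ (by fun_prop))
    fun_prop
  have hall := (((effClosed_codes (α := List Bool × ℕ × ℕ)).and h1).and
    ((h2.and h3).and (h4.and h5))).isPi01
  convert hall using 1
  ext X
  simp only [Set.mem_ofPred_eq, martingaleClass, Set.mem_image, Bool.or_eq_true,
    Bool.not_eq_true', decide_eq_true_eq, beq_iff_eq, List.any_eq_true, mem_strings, or_assoc,
    dyadicEq_iff, dyadicGt_iff hr, dyadic_dyadicAdd, forall_const]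
  have hdouble : ∀ p : ℕ × ℕ, dyadic (2 * p.1, p.2) = 2 * dyadic p := fun p => by
    simp only [dyadic]
    push_cast
    ring
  simp only [hdouble]
  constructor
  · rintro ⟨D, ⟨hD, hroot, hdom, hcode⟩, rfl⟩
    have hmem : ∀ σ p, charSeq {p : List Bool × ℕ × ℕ | D p.1 = dyadic p.2} (encode (σ, p)) = true ↔
        D σ = dyadic p := fun σ p => charSeq_encode
    have hor : ∀ σ p (P : Prop), (D σ = dyadic p → P) →
        (charSeq {p : List Bool × ℕ × ℕ | D p.1 = dyadic p.2} (encode (σ, p)) = false ∨ P) := by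
      intro σ n P h
      rw [← Bool.not_eq_true, hmem]
      exact not_or_of_imp h
    refine ⟨⟨fun n => ?_, fun p => ?_⟩, ⟨fun σ => ?_, fun p => ?_⟩, ?_, fun p => ?_⟩
    · simpa using charSeq_codes {p : List Bool × ℕ × ℕ | D p.1 = dyadic p.2} n
    · refine hor _ _ _ fun h => ?_
      rw [Bool.eq_iff_iff, hmem, h, dyadicEq_iff]
    · obtain ⟨τ, h3, h4⟩ := hcode σ
      exact ⟨τ, h3, (hmem _ _).2 h4⟩
    · refine hor _ _ _ fun h => hor _ _ _ fun h' => hor _ _ _ fun h'' => ?_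
      rw [← h, ← h', ← h'']
      exact hD.fair p.1
    · rw [hmem, hroot]
      simp [dyadic]
    · refine hor _ _ _ fun h => ?_
      by_cases hs : q (p.2.2.1, p.1, p.2.2.2) = true
      · right
        refine or_iff_not_imp_left.2 fun hlt => ?_
        rw [← h]
        have h3 := complexity_le ((hqU _ _).2 ⟨_, hs⟩)
        exact hdom _ (by omega)
      · exact Or.inl (by simpa using hs)
  · rintro ⟨⟨h0, h1⟩, ⟨h2, h3⟩, h4, h5⟩
    choose t ht1 ht2 using h2
    have hX : X = charSeq {p : List Bool × ℕ × ℕ | dyadic (ν (t p.1)) = dyadic p.2} := by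
      refine eq_charSeq (fun p => ?_) (fun n => by simpa using h0 n)
      have h6 := h1 (p.1, ν (t p.1), p.2)
      simp only [ht2, Bool.true_eq_false, false_or] at h6
      rw [Set.mem_ofPred_eq, ← dyadicEq_iff, ← h6]
    have hmem : ∀ σ p, X (encode (σ, p)) = true ↔ dyadic (ν (t σ)) = dyadic p := fun σ p => by
      rw [hX]; exact charSeq_encode
    refine ⟨fun σ => dyadic (ν (t σ)), ⟨⟨fun σ => ?_, fun σ => ?_⟩, ?_, fun σ hσ => ?_,
      fun σ => ⟨t σ, ht1 σ, rfl⟩⟩, hX.symm⟩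
    · unfold dyadic
      positivity
    · have := h3 (σ, ν (t σ), ν (t (σ ++ [false])), ν (t (σ ++ [true])))
      simpa only [ht2, Bool.true_eq_false, false_or] using this
    · simpa [dyadic] using (hmem _ _).1 h4
    · obtain ⟨τ, hτ, hτK⟩ := hU.exists_program σ
      obtain ⟨s, hs⟩ := (hqU _ _).1 hτ
      have := h5 (σ, ν (t σ), τ, s)
      simp only [ht2, hs, Bool.true_eq_false, false_or] at this
      exact this.resolve_left (by omega)

theorem IsMartingale.sum_stringsOf {D : List Bool → ℚ} (hD : IsMartingale D) (n : ℕ) :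
    ∑ σ ∈ stringsOf n, D σ = 2 ^ n * D [] := by
  induction n with
  | zero => simp [stringsOf, strings]
  | succ n ih =>
    rw [sum_stringsOf_succ, Finset.sum_congr rfl fun σ _ => (hD.fair σ).symm, ← Finset.mul_sum,
      ih, pow_succ]
    ring

/-- By Markov's inequality at most a fraction $1/(1+r)$ of the strings has $D>1+r$. The rest is a
fraction of at least $r/(1+r)\ge 2^{-e}$. -/
theorem IsMartingale.le_card_mul {D : List Bool → ℚ} (hD : IsMartingale D) (h1 : D [] = 1) {r : ℚ}
    (hr : 0 < r) {e : ℕ} (he : 1 + r ≤ 2 ^ e * r) (n : ℕ) :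
    2 ^ n ≤ ((stringsOf n).filter fun σ => ¬ 1 + r < D σ).card * 2 ^ e := by
  have hbad : (((stringsOf n).filter fun σ => 1 + r < D σ).card : ℚ) * (1 + r) ≤ 2 ^ n := by
    rw [← nsmul_eq_mul, ← Finset.sum_const]
    calc ∑ σ ∈ (stringsOf n).filter (fun σ => 1 + r < D σ), (1 + r)
        ≤ ∑ σ ∈ (stringsOf n).filter (fun σ => 1 + r < D σ), D σ :=
          Finset.sum_le_sum fun σ hσ => (Finset.mem_filter.1 hσ).2.le
      _ ≤ ∑ σ ∈ stringsOf n, D σ := Finset.sum_le_sum_of_subset_of_nonneg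
          (Finset.filter_subset _ _) fun σ _ _ => hD.nonneg σ
      _ = 2 ^ n := by rw [hD.sum_stringsOf, h1, mul_one]
  have hcard := Finset.card_filter_add_card_filter_not (s := stringsOf n) (fun σ => 1 + r < D σ)
  rw [card_stringsOf] at hcard
  have hcard' : (((stringsOf n).filter fun σ => 1 + r < D σ).card : ℚ) +
      ((stringsOf n).filter fun σ => ¬ 1 + r < D σ).card = 2 ^ n := by exact_mod_cast hcard
  set x : ℚ := (((stringsOf n).filter fun σ => 1 + r < D σ).card : ℚ)
  have hmain : (2 : ℚ) ^ n ≤ ((stringsOf n).filter fun σ => ¬ 1 + r < D σ).card * 2 ^ e := by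
    set y : ℚ := (((stringsOf n).filter fun σ => ¬ 1 + r < D σ).card : ℚ)
    have h2 : 2 ^ n * r ≤ y * (1 + r) := by
      have : 2 ^ n * (1 + r) = x * (1 + r) + y * (1 + r) := by rw [← hcard']; ring
      linarith
    have h3 : 2 ^ n * r ≤ y * 2 ^ e * r := by
      calc 2 ^ n * r ≤ y * (1 + r) := h2
        _ ≤ y * (2 ^ e * r) := mul_le_mul_of_nonneg_left he (Nat.cast_nonneg _)
        _ = y * 2 ^ e * r := by ring
    exact le_of_mul_le_mul_right h3 hr
  exact_mod_cast hmain

theorem isDeep_martingaleClass {U : List Bool →. List Bool} (hU : IsUniversalMachine U)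
    {M : List Bool → ℝ} (hM : IsUniversalSemimeasure M) {ν : List Bool → ℕ × ℕ} {g : ℕ → ℕ} {r : ℚ}
    (hν : Computable ν) (hg : Computable g) (hr : 0 < r) :
    IsDeep M (martingaleClass U ν g r) := by
  obtain ⟨e, he⟩ : ∃ e : ℕ, 1 + r ≤ 2 ^ e * r := by
    obtain ⟨e, he⟩ := pow_unbounded_of_one_lt ((1 + r) / r) (by norm_num : (1 : ℚ) < 2)
    exact ⟨e, ((div_lt_iff₀ hr).1 he).le⟩
  -- The value of `D` is found among the codes of the prescribed length and then compared with `1 +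
  -- r`.
  have hR : TruthTable (fun (p : ℕ × List Bool) X => (strings (g p.2.length)).any fun τ =>
      X (encode (p.2, ν τ)) && !dyadicGt r.num.toNat r.den (ν τ)) :=
    TruthTable.any (F := fun (p : (ℕ × List Bool) × List Bool) (X : ℕ → Bool) =>
        X (encode (p.1.2, ν p.2)) && !dyadicGt r.num.toNat r.den (ν p.2))
      (TruthTable.comp_query
        (g := fun p : ((ℕ × List Bool) × List Bool) × Bool =>
          p.2 && !dyadicGt r.num.toNat r.den (ν p.1.2)) (by fun_prop) (by fun_prop))
      (by fun_prop)
  have hRD : ∀ D ∈ DominatingMartingales U ν g r, ∀ σ, ((strings (g σ.length)).any fun τ =>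
      charSeq {p : List Bool × ℕ × ℕ | D p.1 = dyadic p.2} (encode (σ, ν τ)) &&
        !dyadicGt r.num.toNat r.den (ν τ)) = true ↔ ¬ 1 + r < D σ := by
    rintro D ⟨-, -, -, hcode⟩ σ
    simp only [List.any_eq_true, mem_strings, Bool.and_eq_true, charSeq_encode,
      Set.mem_ofPred_eq, Bool.not_eq_true', ← Bool.not_eq_true, dyadicGt_iff hr]
    constructor
    · rintro ⟨τ, -, h1, h2⟩
      rwa [h1]
    · intro h
      obtain ⟨τ, h1, h2⟩ := hcode σ
      exact ⟨τ, h1, h2, h2 ▸ h⟩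
  -- Strings with `D σ ≤ 1 + r` have complexity at least their length `ℓ = L + 2 * m + 2`; they make
  -- up a fraction of at least $2^{-e}$, whence `L = m + e`.
  refine isDeep_of_complex_strings hU hM (isPi01_martingaleClass hU hν hg hr)
    (ℓ := fun m => 3 * m + e + 2) (L := fun m => m + e) (by fun_prop) (by fun_prop) hR ?_ ?_
  · rintro _ ⟨D, hD, rfl⟩ m
    simp only [hRD D hD]
    have h1 := hD.1.le_card_mul hD.2.1 hr he (3 * m + e + 2)
    rw [pow_add, pow_add 2 m e, mul_left_comm]
    exact Nat.mul_le_mul_left _ h1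
  · rintro _ ⟨D, hD, rfl⟩ m σ hlen hσ
    have h1 := (hRD D hD σ).1 hσ
    have h2 : ¬ complexity U σ < σ.length := fun h => h1 (hD.2.2.1 σ h)
    omega

end DeepClasses

open DeepClasses in
theorem mainTheorem9
    (U : List Bool →. List Bool) (hU : IsUniversalMachine U)
    (M : List Bool → ℝ) (hM : IsUniversalSemimeasure M) :
    (∀ f ℓ d : ℕ → ℕ, Computable f → Computable ℓ → Computable d → Monotone ℓ →
      (∀ B : ℝ, ∃ i, B < (f i : ℝ) / 2 ^ d i) →
      IsDeep M (complexSetsClass U f ℓ d)) ∧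
    (∀ c : ℕ, IsDeep M (compressionClass U c)) ∧
    (∀ (ν : List Bool → ℕ × ℕ) (g : ℕ → ℕ) (r : ℚ), Computable ν → Computable g → 0 < r →
      IsDeep M (martingaleClass U ν g r)) :=
  ⟨fun _ _ _ hf hℓ hd _ hlarge => isDeep_complexSetsClass hU hM hf hℓ hd hlarge,
    fun c => isDeep_compressionClass hU hM c,
    fun _ _ _ hν hg hr => isDeep_martingaleClass hU hM hν hg hr⟩
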